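/- **Branch-point splitting for a single-harmonic perturbation.** Let $L>0$ and let $n\ge 1$ be an integer with $L\neq \pi n$. Put $\mu_n=\pi n/L$ and $\lambda_n=\sqrt{\mu_n^2-1}$, where $\lambda_n=i\sqrt{1-\mu_n^2}$ if $\mu_n<1$ (unstable mode) and $\lambda_n>0$ if $\mu_n>1$ (stable mode). For $c_n,c_{-n}\in\mathbb C$ let $$u(x)=1+c_ne^{2\pi i nx/L}+c_{-n}e^{-2\pi i nx/L},$$ $$\alpha_n=\overline{c_n}-(\mu_n+\lambda_n)^2c_{-n},\quad \beta_n=\overline{c_{-n}}-(\mu_n-\lambda_n)^2c_n,\quad \tilde\alpha_n=\overline{c_n}-(\mu_n-\lambda_n)^2c_{-n},\quad \tilde\beta_n=\overline{c_{-n}}-(\mu_n+\lambda_n)^2c_n .$$ Let $T(\lambda)=\Psi(L)$ be the monodromy matrix of the Zakharov–Shabat problem $$\Psi_x=\begin{pmatrix}-i\lambda & iu\\ i\overline u & i\lambda\end{pmatrix}\Psi,\qquad \Psi(0)=I,$$ i.e. of $\mathcal L\psi=\lambda\psi$ with $\mathcal L=\begin{pmatrix} i\partial_x&u\\-\overline u&-i\partial_x\end{pmatrix}$.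 Let $D(\lambda)=(\operatorname{tr}T)^2-4\det T$ be the discriminant of the spectral curve $\Gamma:\ \det(T(\lambda)-\kappa)=0$. The branch points of $\Gamma$ are the zeros of $D$ of odd order. If $c_n=c_{-n}=0$, then $T(\pm\lambda_n)=(-1)^nI$ and $D$ has a zero of order exactly two (a double point) at each of $\pm\lambda_n$. There are $r,\epsilon_0,C>0$, depending only on $L$ and $n$, such that the following holds whenever $0<\epsilon<\epsilon_0$ and $|c_n|,|c_{-n}|\le\epsilon$. Fix any values of the square roots $\sqrt{\alpha_n\beta_n}$ and $\sqrt{\tilde\alpha_n\tilde\beta_n}$. The zeros of $D$ in the disc $|\lambda-\lambda_n|<r$, counted with multiplicity, are exactly two points $E_{2n-1},E_{2n}$, and those in $|\lambda+\lambda_n|<r$ are exactly two points $\tilde E_{2n-1},\tilde E_{2n}$. All four are eigenvalues of $\mathcal L$ on functions with $\psi(x+L)=(-1)^n\psi(x)$, and they can be labelled so that $$E_l=\lambda_n\mp\frac1{2\lambda_n}\sqrt{\alpha_n\beta_n}+O(\epsilon^2),\qquad \tilde E_l=-\lambda_n\pm\frac1{2\lambda_n}\sqrt{\tilde\alpha_n\tilde\beta_n}+O(\epsilon^2),\qquad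 l=2n-1,2n,$$ (upper sign for $l=2n-1$, lower sign for $l=2n$), and $$\delta_n^+:=E_{2n}-E_{2n-1}=\frac{\sqrt{\alpha_n\beta_n}}{\lambda_n}+O(\epsilon^2),\qquad \delta_n^-:=\tilde E_{2n}-\tilde E_{2n-1}=-\frac{\sqrt{\tilde\alpha_n\tilde\beta_n}}{\lambda_n}+O(\epsilon^2),$$ where every $O(\epsilon^2)$ is bounded in modulus by $C\epsilon^2$. If $|\sqrt{\alpha_n\beta_n}|>C\epsilon^2$, then $E_{2n-1}\ne E_{2n}$ are branch points of $\Gamma$; likewise for $\tilde E_{2n-1},\tilde E_{2n}$ if $|\sqrt{\tilde\alpha_n\tilde\beta_n}|>C\epsilon^2$. (In particular, if $c_{\pm n}=\epsilon a_{\pm}$ with fixed $a_\pm$, $|a_\pm|\le 1$, for which $\alpha_n\beta_n\neq0$, this holds for all small $\epsilon$.) If the mode is unstable ($\pi n<L$) and the square roots are chosen so that $\sqrt{\tilde\alpha_n\tilde\beta_n}=\overline{\sqrt{\alpha_n\beta_n}}$, then the labelling can be chosen with $\tilde E_l=\overline{E_l}$ for both $l$, and so $\delta_n^-=\overline{\delta_n^+}$.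 -/

import Mathlib

namespace ZakharovShabat

open Complex

/-! ### The Zakharov-Shabat spectral problem at a fixed time -/

/-- The matrix `U(x)` of the linear problem `Ψ_x = U Ψ` with potential `u` and spectral
parameter `z`. -/
noncomputable def zsMatrix (u : ℝ → ℂ) (z : ℂ) (x : ℝ) : Matrix (Fin 2) (Fin 2) ℂ :=
  !![-(I * z), I * u x; I * (starRingEnd ℂ) (u x), I * z]

/-- The Zakharov-Shabat operator `[[i ∂, u], [-ū, -i ∂]]` applied to a vector function `ψ`. -/
noncomputable def zsOperator (u : ℝ → ℂ) (ψ : ℝ → Fin 2 → ℂ) (x : ℝ) : Fin 2 → ℂ :=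
  ![I * deriv (fun y => ψ y 0) x + u x * ψ x 1,
    -(starRingEnd ℂ) (u x) * ψ x 0 - I * deriv (fun y => ψ y 1) x]

/-- `z` is an eigenvalue of the Zakharov-Shabat operator on the space of functions with
`ψ (x + L) = κ ψ x` (periodic functions for `κ = 1`, antiperiodic functions for `κ = -1`). -/
def IsBlochEigenvalue (u : ℝ → ℂ) (L : ℝ) (κ z : ℂ) : Prop :=
  ∃ ψ : ℝ → Fin 2 → ℂ, ψ ≠ 0 ∧ (∀ i, Differentiable ℝ fun x => ψ x i) ∧
    (∀ x, zsOperator u ψ x = z • ψ x) ∧ ∀ x, ψ (x + L) = κ • ψ x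

/-- `Ψ` is the fundamental matrix of `Ψ_x = U Ψ` normalized to the identity at `x = 0`. -/
structure IsFundamental (u : ℝ → ℂ) (z : ℂ) (Ψ : ℝ → Matrix (Fin 2) (Fin 2) ℂ) : Prop where
  init : Ψ 0 = 1
  deriv : ∀ x i j, HasDerivAt (fun y => Ψ y i j) ((zsMatrix u z x * Ψ x) i j) x

/-! Existence and uniqueness of the fundamental matrix for a continuous potential. -/

theorem clampReal_abs_sub_le (R x y : ℝ) :
    |max (-R) (min R x) - max (-R) (min R y)| ≤ |x - y| := by
  refine (abs_max_sub_max_le_max _ _ _ _).trans ?_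
  refine max_le (by simp) ?_
  refine (abs_min_sub_min_le_max _ _ _ _).trans ?_
  exact max_le (by simp) le_rfl

noncomputable def clampVec (R : ℝ) (v : Fin 2 → ℂ) : Fin 2 → ℂ :=
  fun i => ⟨max (-R) (min R (v i).re), max (-R) (min R (v i).im)⟩

theorem clampVec_sub_le (R : ℝ) (v w : Fin 2 → ℂ) :
    ‖clampVec R v - clampVec R w‖ ≤ 2 * ‖v - w‖ := by
  refine (pi_norm_le_iff_of_nonneg (by positivity)).2 fun i => ?_
  have h1 := clampReal_abs_sub_le R (v i).re (w i).re
  have h2 := clampReal_abs_sub_le R (v i).im (w i).im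
  have h3 := Complex.abs_re_le_norm (v i - w i)
  have h4 := Complex.abs_im_le_norm (v i - w i)
  have h5 : ‖v i - w i‖ ≤ ‖v - w‖ := norm_le_pi_norm (v - w) i
  have h6 := Complex.norm_le_abs_re_add_abs_im ((clampVec R v - clampVec R w) i)
  simp only [clampVec, Pi.sub_apply, Complex.sub_re, Complex.sub_im] at *
  linarith

theorem clampVec_zero {R : ℝ} (hR : 0 ≤ R) : clampVec R 0 = 0 := by
  funext i
  apply Complex.ext <;> simp [clampVec, hR]

theorem clampVec_norm_le {R : ℝ} (hR : 0 ≤ R) (v : Fin 2 → ℂ) : ‖clampVec R v‖ ≤ 2 * ‖v‖ := by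
  simpa [clampVec_zero hR] using clampVec_sub_le R v 0

theorem clampVec_norm_le' {R : ℝ} (hR : 0 ≤ R) (v : Fin 2 → ℂ) : ‖clampVec R v‖ ≤ 2 * R := by
  refine (pi_norm_le_iff_of_nonneg (by positivity)).2 fun i => ?_
  have h6 := Complex.norm_le_abs_re_add_abs_im (clampVec R v i)
  have h (x : ℝ) : |max (-R) (min R x)| ≤ R :=
    abs_le.2 ⟨le_max_left _ _, max_le (by linarith) (min_le_left _ _)⟩
  have h1 := h (v i).re
  have h2 := h (v i).im
  simp only [clampVec] at *
  linarith

theorem clampVec_of_norm_le {R : ℝ} {v : Fin 2 → ℂ} (h : ‖v‖ ≤ R) : clampVec R v = v := by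
  funext i
  have h3 := abs_le.1 ((Complex.abs_re_le_norm (v i)).trans ((norm_le_pi_norm v i).trans h))
  have h4 := abs_le.1 ((Complex.abs_im_le_norm (v i)).trans ((norm_le_pi_norm v i).trans h))
  apply Complex.ext <;> simp [clampVec, h3.1, h3.2, h4.1, h4.2]

theorem linearODE_exists_Icc {A : ℝ → (Fin 2 → ℂ) →L[ℂ] (Fin 2 → ℂ)} (hA : Continuous A)
    (v₀ : Fin 2 → ℂ) {T : ℝ} (hT : 0 < T) :
    ∃ f : ℝ → Fin 2 → ℂ, f 0 = v₀ ∧ ContinuousOn f (Set.Icc (-T) T) ∧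
      ∀ t ∈ Set.Ioo (-T) T, HasDerivAt f (A t (f t)) t := by
  obtain ⟨K, hK⟩ := (isCompact_Icc (a := -T) (b := T)).exists_bound_of_continuousOn hA.continuousOn
  have hK0 : 0 ≤ K := (norm_nonneg _).trans (hK 0 ⟨by linarith, hT.le⟩)
  set R : ℝ := gronwallBound ‖v₀‖ (2 * K) 0 T with hR
  have hR0 : 0 ≤ R := by rw [hR, gronwallBound_ε0]; positivity
  have hmem0 : (0 : ℝ) ∈ Set.Icc (-T) T := ⟨by linarith, hT.le⟩
  have hPL : IsPicardLindelof (fun t v => A t (clampVec R v)) (⟨0, hmem0⟩ : Set.Icc (-T) T) v₀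
      (⟨K * (2 * R) * T, by positivity⟩ : NNReal) 0 (⟨K * (2 * R), by positivity⟩ : NNReal)
      (⟨K * 2, by positivity⟩ : NNReal) := by
    refine ⟨fun t ht => ?_, fun v _ => ?_, fun t ht v _ => ?_, ?_⟩
    · refine LipschitzOnWith.of_dist_le_mul fun v _ w _ => ?_
      rw [dist_eq_norm, dist_eq_norm, ← map_sub]
      refine ((A t).le_opNorm _).trans ?_
      have := mul_le_mul (hK t ht) (clampVec_sub_le R v w) (norm_nonneg _) hK0
      rw [← mul_assoc] at this
      exact this
    · exact (hA.clm_apply continuous_const).continuousOn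
    · refine ((A t).le_opNorm _).trans ?_
      exact mul_le_mul (hK t ht) (clampVec_norm_le' hR0 v) (norm_nonneg _) hK0
    · simp only [sub_zero, zero_sub, neg_neg, max_self, NNReal.coe_zero]
      exact le_rfl
  obtain ⟨f, hf0, hf⟩ := hPL.exists_eq_forall_mem_Icc_hasDerivWithinAt₀
  have hf0 : f 0 = v₀ := hf0
  have hcont : ContinuousOn f (Set.Icc (-T) T) := fun t ht => (hf t ht).continuousWithinAt
  have hder : ∀ t ∈ Set.Ioo (-T) T, HasDerivAt f (A t (clampVec R (f t))) t := fun t ht =>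
    (hf t ⟨ht.1.le, ht.2.le⟩).hasDerivAt (Icc_mem_nhds ht.1 ht.2)
  have hb : ∀ t ∈ Set.Icc (-T) T, ‖A t (clampVec R (f t))‖ ≤ 2 * K * ‖f t‖ + 0 := fun t ht => by
    refine ((A t).le_opNorm _).trans ?_
    have := mul_le_mul (hK t ht) (clampVec_norm_le hR0 (f t)) (norm_nonneg _) hK0
    linarith
  have hmono : ∀ t ∈ Set.Icc 0 T, gronwallBound ‖v₀‖ (2 * K) 0 (t - 0) ≤ R := fun t ht => by
    rw [hR, gronwallBound_ε0, gronwallBound_ε0, sub_zero]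
    have := ht.2
    gcongr
  have hpos : ∀ t ∈ Set.Icc 0 T, ‖f t‖ ≤ R := fun t ht =>
    (norm_le_gronwallBound_of_norm_deriv_right_le (f' := fun t => A t (clampVec R (f t)))
      (hcont.mono (Set.Icc_subset_Icc_left (by linarith)))
      (fun x hx => (hder x ⟨by linarith [hx.1], hx.2⟩).hasDerivWithinAt) (by rw [hf0])
      (fun x hx => hb x ⟨by linarith [hx.1], hx.2.le⟩) t ht).trans (hmono t ht)
  have hneg : ∀ t ∈ Set.Icc 0 T, ‖f (-t)‖ ≤ R := fun t ht =>
    (norm_le_gronwallBound_of_norm_deriv_right_le (f := fun t => f (-t))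
      (f' := fun t => -(A (-t) (clampVec R (f (-t)))))
      (hcont.comp continuous_neg.continuousOn
        (fun x hx => ⟨by linarith [hx.2], by linarith [hx.1]⟩))
      (fun x hx => by
        have := (hder (-x) ⟨by linarith [hx.2], by linarith [hx.1]⟩).scomp x (hasDerivAt_neg x)
        rw [neg_one_smul] at this
        exact this.hasDerivWithinAt) (by simp [hf0])
      (fun x hx => by
        simpa using hb (-x) ⟨by linarith [hx.2], by linarith [hx.1]⟩) t ht).trans (hmono t ht)
  refine ⟨f, hf0, hcont, fun t ht => ?_⟩
  have hle : ‖f t‖ ≤ R := by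
    rcases le_total 0 t with h | h
    · exact hpos t ⟨h, ht.2.le⟩
    · simpa using hneg (-t) ⟨by linarith, by linarith [ht.1]⟩
  simpa [clampVec_of_norm_le hle] using hder t ht

theorem linearODE_unique_Ioo {A : ℝ → (Fin 2 → ℂ) →L[ℂ] (Fin 2 → ℂ)} (hA : Continuous A)
    {T : ℝ} (hT : 0 < T) {f g : ℝ → Fin 2 → ℂ} (h0 : f 0 = g 0)
    (hf : ∀ t ∈ Set.Ioo (-T) T, HasDerivAt f (A t (f t)) t)
    (hg : ∀ t ∈ Set.Ioo (-T) T, HasDerivAt g (A t (g t)) t) :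
    Set.EqOn f g (Set.Ioo (-T) T) := by
  obtain ⟨K, hK⟩ := (isCompact_Icc (a := -T) (b := T)).exists_bound_of_continuousOn hA.continuousOn
  have hK0 : 0 ≤ K := (norm_nonneg _).trans (hK 0 ⟨by linarith, hT.le⟩)
  refine ODE_solution_unique_of_mem_Ioo (v := fun t v => A t v) (s := fun _ => Set.univ)
    (K := ⟨K, hK0⟩) (t₀ := 0) (fun t ht => ?_) ⟨by linarith, hT⟩
    (fun t ht => ⟨hf t ht, trivial⟩) (fun t ht => ⟨hg t ht, trivial⟩) h0
  refine LipschitzOnWith.of_dist_le_mul fun v _ w _ => ?_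
  rw [dist_eq_norm, dist_eq_norm, ← map_sub]
  exact ((A t).le_opNorm _).trans
    (mul_le_mul_of_nonneg_right (hK t ⟨ht.1.le, ht.2.le⟩) (norm_nonneg _))

theorem linearODE_exists {A : ℝ → (Fin 2 → ℂ) →L[ℂ] (Fin 2 → ℂ)} (hA : Continuous A)
    (v₀ : Fin 2 → ℂ) :
    ∃ f : ℝ → Fin 2 → ℂ, f 0 = v₀ ∧ ∀ t, HasDerivAt f (A t (f t)) t := by
  choose F hF0 _ hF using fun m : ℕ => linearODE_exists_Icc hA v₀ (T := (m : ℝ) + 1) (by positivity)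
  have hag : ∀ m k : ℕ, m ≤ k → Set.EqOn (F m) (F k) (Set.Ioo (-((m : ℝ) + 1)) ((m : ℝ) + 1)) := by
    intro m k hmk
    have hmk' : (m : ℝ) ≤ k := by exact_mod_cast hmk
    exact linearODE_unique_Ioo hA (by positivity) (by rw [hF0, hF0]) (hF m)
      (fun t ht => hF k t ⟨by linarith [ht.1], by linarith [ht.2]⟩)
  have key : ∀ (m : ℕ) (t : ℝ), t ∈ Set.Ioo (-((m : ℝ) + 1)) ((m : ℝ) + 1) →
      F ⌈|t|⌉₊ t = F m t := by
    intro m t ht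
    have ht' : t ∈ Set.Ioo (-((⌈|t|⌉₊ : ℝ) + 1)) ((⌈|t|⌉₊ : ℝ) + 1) := by
      have := Nat.le_ceil |t|
      rw [Set.mem_Ioo, ← abs_lt]
      linarith
    rcases le_total m ⌈|t|⌉₊ with h | h
    · exact (hag _ _ h ht).symm
    · exact hag _ _ h ht'
  refine ⟨fun t => F ⌈|t|⌉₊ t, by simp [hF0], fun t => ?_⟩
  have hm : t ∈ Set.Ioo (-((⌈|t|⌉₊ : ℝ) + 1)) ((⌈|t|⌉₊ : ℝ) + 1) := by
    have := Nat.le_ceil |t|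
    rw [Set.mem_Ioo, ← abs_lt]
    linarith
  refine (hF ⌈|t|⌉₊ t hm).congr_of_eventuallyEq ?_
  filter_upwards [isOpen_Ioo.mem_nhds hm] with x hx using key _ _ hx

theorem continuous_zsMatrix {u : ℝ → ℂ} (hu : Continuous u) (z : ℂ) :
    Continuous (zsMatrix u z) := by
  refine continuous_matrix fun i j => ?_
  fin_cases i <;> fin_cases j <;> simp [zsMatrix] <;> fun_prop

/-- The matrix of the linear problem as a continuous family of operators on `ℂ²`. -/
noncomputable def zsCLM (u : ℝ → ℂ) (z : ℂ) (x : ℝ) : (Fin 2 → ℂ) →L[ℂ] (Fin 2 → ℂ) :=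
  LinearMap.toContinuousLinearMap (Matrix.toLin' (zsMatrix u z x))

theorem continuous_zsCLM {u : ℝ → ℂ} (hu : Continuous u) (z : ℂ) : Continuous (zsCLM u z) := by
  have h : Continuous ((LinearMap.toContinuousLinearMap (𝕜 := ℂ) (E := Fin 2 → ℂ)
      (F' := Fin 2 → ℂ)).toLinearMap ∘ₗ
      (Matrix.toLin' (R := ℂ) (m := Fin 2) (n := Fin 2)).toLinearMap) :=
    LinearMap.continuous_of_finiteDimensional _
  exact h.comp (continuous_zsMatrix hu z)

theorem isFundamental_iff_columns {u : ℝ → ℂ} {z : ℂ} {Ψ : ℝ → Matrix (Fin 2) (Fin 2) ℂ} :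
    IsFundamental u z Ψ ↔ ∀ j, (fun i => Ψ 0 i j) = (fun i => (1 : Matrix (Fin 2) (Fin 2) ℂ) i j) ∧
      ∀ x, HasDerivAt (fun y i => Ψ y i j) (zsCLM u z x fun i => Ψ x i j) x := by
  have e : ∀ x i j, (zsMatrix u z x * Ψ x) i j = zsCLM u z x (fun i => Ψ x i j) i := by
    intro x i j
    simp [zsCLM, Matrix.mul_apply, Matrix.mulVec, dotProduct]
  constructor
  · intro h j
    refine ⟨by rw [h.init], fun x => hasDerivAt_pi.2 fun i => ?_⟩
    rw [← e]
    exact h.deriv x i j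
  · intro h
    refine ⟨?_, fun x i j => ?_⟩
    · ext i j
      exact congrFun (h j).1 i
    · rw [e]
      exact hasDerivAt_pi.1 ((h j).2 x) i

theorem existsUnique_isFundamental {u : ℝ → ℂ} (hu : Continuous u) (z : ℂ) :
    ∃! Ψ, IsFundamental u z Ψ := by
  choose f hf0 hf using fun j : Fin 2 => linearODE_exists (continuous_zsCLM hu z)
    (fun i => (1 : Matrix (Fin 2) (Fin 2) ℂ) i j)
  refine ⟨fun x => Matrix.of fun i j => f j x i,
    isFundamental_iff_columns.2 fun j => ⟨hf0 j, hf j⟩, fun Φ hΦ => ?_⟩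
  have hΦ' := isFundamental_iff_columns.1 hΦ
  funext x
  ext i j
  have hT : 0 < |x| + 1 := by positivity
  have := linearODE_unique_Ioo (continuous_zsCLM hu z) hT ((hΦ' j).1.trans (hf0 j).symm)
    (fun t _ => (hΦ' j).2 t) (fun t _ => hf j t) (abs_lt.1 (lt_add_one |x|))
  exact congrFun this i

open Classical in
/-- The monodromy matrix `Ψ(L)` (for a continuous potential, the fundamental matrix `Ψ` exists and
is unique). -/
noncomputable def monodromy (u : ℝ → ℂ) (L : ℝ) (z : ℂ) : Matrix (Fin 2) (Fin 2) ℂ :=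
  if h : ∃ Ψ, IsFundamental u z Ψ then h.choose L else 0

theorem monodromy_eq {u : ℝ → ℂ} (hu : Continuous u) (L : ℝ) {z : ℂ}
    {Ψ : ℝ → Matrix (Fin 2) (Fin 2) ℂ} (hΨ : IsFundamental u z Ψ) :
    monodromy u L z = Ψ L := by
  have h : ∃ Ψ, IsFundamental u z Ψ := ⟨Ψ, hΨ⟩
  rw [monodromy, dif_pos h, (existsUnique_isFundamental hu z).unique h.choose_spec hΨ]

/-- The discriminant (with respect to `κ`) of the equation `κ² - tr T(z) κ + det T(z) = 0` of the
spectral curve `Γ`, the two-sheeted covering of the `z`-plane on which the eigenvalues of the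
monodromy matrix `T(z)` live. -/
noncomputable def curveDiscr (u : ℝ → ℂ) (L : ℝ) (z : ℂ) : ℂ :=
  (monodromy u L z).discr

/-- `E` is a (square-root) branch point of the spectral curve: the discriminant vanishes at `E` to
an odd order. -/
def IsBranchPoint (u : ℝ → ℂ) (L : ℝ) (E : ℂ) : Prop :=
  Odd (analyticOrderNatAt (curveDiscr u L) E)

/-- Inside the disc of centre `a` and radius `r`, the zeros of the discriminant, listed with their
multiplicities, are `E 0` and `E 1`. So these are either two distinct branch points, or a single
double point `E 0 = E 1`. -/
def IsSpectralPair (u : ℝ → ℂ) (L : ℝ) (a : ℂ) (r : ℝ) (E : Fin 2 → ℂ) : Prop :=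
  (∀ l, E l ∈ Metric.ball a r) ∧
    ∀ z ∈ Metric.ball a r,
      analyticOrderAt (curveDiscr u L) z = ((Finset.univ.filter fun l => E l = z).card : ℕ∞)

/-! ### Single-harmonic perturbation of the constant background -/

/-- The initial datum `1 + c₊ e^{i k x} + c₋ e^{-i k x}`, `k = 2 π n / L`. -/
noncomputable def potential (L : ℝ) (n : ℕ) (cp cm : ℂ) (x : ℝ) : ℂ :=
  1 + (cp * exp (I * (2 * Real.pi * n / L : ℝ) * x) + cm * exp (-(I * (2 * Real.pi * n / L : ℝ) * x)))

theorem continuous_potential (L : ℝ) (n : ℕ) (cp cm : ℂ) : Continuous (potential L n cp cm) := by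
  unfold potential
  fun_prop

/-- `μ_n = π n / L`. -/
noncomputable def mu (L : ℝ) (n : ℕ) : ℝ := Real.pi * n / L

/-- `λ_n = √(μ_n² - 1)`, with the root for which `Re λ_n + Im λ_n ≥ 0`: it is `i √(1 - μ_n²)` for
unstable modes (`μ_n < 1`) and `√(μ_n² - 1)` for stable ones. -/
noncomputable def lam (L : ℝ) (n : ℕ) : ℂ :=
  if mu L n < 1 then I * (Real.sqrt (1 - mu L n ^ 2) : ℝ) else (Real.sqrt (mu L n ^ 2 - 1) : ℝ)

/-- `α_n`, where `cp`, `cm` are the Fourier coefficients `c_n`, `c_{-n}`. -/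
noncomputable def alpha (L : ℝ) (n : ℕ) (cp cm : ℂ) : ℂ :=
  (starRingEnd ℂ) cp - (mu L n + lam L n) ^ 2 * cm

/-- `β_n`. -/
noncomputable def beta (L : ℝ) (n : ℕ) (cp cm : ℂ) : ℂ :=
  (starRingEnd ℂ) cm - (mu L n - lam L n) ^ 2 * cp

/-- `α̃_n`. -/
noncomputable def alphaTilde (L : ℝ) (n : ℕ) (cp cm : ℂ) : ℂ :=
  (starRingEnd ℂ) cp - (mu L n - lam L n) ^ 2 * cm

/-- `β̃_n`. -/
noncomputable def betaTilde (L : ℝ) (n : ℕ) (cp cm : ℂ) : ℂ :=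
  (starRingEnd ℂ) cm - (mu L n + lam L n) ^ 2 * cp

end ZakharovShabat

open ZakharovShabat

namespace ZakharovShabat

open Complex

/-! ### Splitting of a double zero of an entire function -/

/-! Write σ = (-1)^n and f = 2 - σ tr T. The linear system is traceless, so det T = 1 and D = (tr
T)² - 4 = f (f - 4). Near ±λ_n the function f is small, hence D and f have the same zeros there. At
such a zero tr T = 2σ, so σ is an eigenvalue of T, which gives the (anti)periodic eigenfunction.

To expand f, put w = ±λ_n, z = w + ζ and c_{±n} = t·(a, b). Conjugating by the eigenvectors of the
constant background turns the problem into Y' = (ζ V₁ + t V₂) Y, Y(0) = 1, and f = det(Y(L) - 1)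
(`exists_frame_solution`). Picard iteration gives Y(L) - 1 = ζ N₁ + t N₂ + (second order) + (third
order), where N₁, N₂ are the integrals of V₁, V₂ over a period. Only non-oscillating terms survive:
N₁ is diagonal with determinant L²w²/μ², and N₂ is off-diagonal with determinant -L²αβ/(4μ²). So f
is a constant times ζ² - t²αβ/(4w²), up to an error.

The shape of that error is decisive. An error O(ε³) would only locate the zeros to O(ε^{3/2}) when
αβ is small or zero. But a shift by L/(2n) replaces c_{±n} by -c_{±n} and conjugates T, so f is even
in t (`trace_monodromy_neg`). Averaging over ±t removes the t³ term and leaves |ζ|³ + t²|ζ| + t⁴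
(`exists_det_expansion`), which is enough for O(ε²) uniformly in the coefficients.

The rest is function theory for an entire F close to ζ² - Y², Y = s/(2w)
(`exists_split_of_norm_sub_le`). The minimum modulus principle yields one zero, then a second one of
the divided slope, and the maximum principle shows that the remaining quotient does not vanish. The
error estimate puts each zero within O(ε²) of Y or -Y. A bound on the sum of the zeros excludes that
both belong to the same sign unless Y itself is O(ε²).

The pair near -λ_n comes from w = -λ_n, or, when conjugation symmetry is demanded, from tr T(z̄)
being the conjugate of tr T(z). -/

/-- Minimum modulus principle: without a zero, the maximum principle applied to 1/f would force
|f(a)| ≥ m. It takes the place of Rouché's theorem. -/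
theorem exists_zero_of_le_norm_sphere {f : ℂ → ℂ} (hf : Differentiable ℂ f) {r m : ℝ} (hr : 0 < r)
    (hm : ∀ z ∈ Metric.sphere (0 : ℂ) r, m ≤ ‖f z‖) {a : ℂ} (ha : a ∈ Metric.ball (0 : ℂ) r)
    (hfa : ‖f a‖ < m) : ∃ z ∈ Metric.ball (0 : ℂ) r, f z = 0 := by
  by_contra! h
  have hm0 : 0 < m := (norm_nonneg _).trans_lt hfa
  have hne : ∀ z ∈ closure (Metric.ball (0 : ℂ) r), f z ≠ 0 := by
    intro z hz
    rw [closure_ball _ hr.ne'] at hz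
    rcases eq_or_lt_of_le (Metric.mem_closedBall.1 hz) with h1 | h1
    · exact norm_pos_iff.1 (hm0.trans_le (hm z (Metric.mem_sphere.2 h1)))
    · exact h z (Metric.mem_ball.2 h1)
  have key := norm_le_of_forall_mem_frontier_norm_le (f := fun z => (f z)⁻¹) (C := m⁻¹)
    Metric.isBounded_ball (hf.diffContOnCl.inv hne) (fun z hz => by
      rw [frontier_ball _ hr.ne'] at hz
      rw [norm_inv]
      exact inv_anti₀ hm0 (hm z hz)) (subset_closure ha)
  rw [norm_inv] at key
  have h0 : 0 < ‖f a‖ := norm_pos_iff.2 (h a ha)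
  exact absurd ((inv_le_inv₀ h0 hm0).1 key) (not_le.2 hfa)

theorem differentiable_dslope {f : ℂ → ℂ} (hf : Differentiable ℂ f) (c : ℂ) :
    Differentiable ℂ (dslope f c) := by
  rw [← differentiableOn_univ]
  exact (differentiableOn_dslope Filter.univ_mem).2 hf.differentiableOn

theorem eq_sub_mul_dslope {f : ℂ → ℂ} {c : ℂ} (hc : f c = 0) (z : ℂ) :
    f z = (z - c) * dslope f c z := by
  have := sub_smul_dslope f c z
  rw [hc, sub_zero, smul_eq_mul] at this
  exact this.symm

/-- A point whose square is close to `Y ^ 2` is close to `Y` or to `-Y`. -/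
theorem norm_sub_le_or_norm_add_le {z Y : ℂ} {a δ : ℝ} (ha : 0 ≤ a) (hδ : 0 ≤ δ)
    (h : ‖z ^ 2 - Y ^ 2‖ ≤ δ * (a * ‖z‖ + δ)) :
    ‖z - Y‖ ≤ (a + 1) * δ ∨ ‖z + Y‖ ≤ (a + 1) * δ := by
  have hz : 2 * ‖z‖ ≤ ‖z - Y‖ + ‖z + Y‖ := by
    have := norm_add_le (z - Y) (z + Y)
    rwa [show z - Y + (z + Y) = 2 * z by ring, norm_mul, Complex.norm_two] at this
  have hp : ‖z - Y‖ * ‖z + Y‖ ≤ δ * (a * ‖z‖ + δ) := by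
    rw [← norm_mul, show (z - Y) * (z + Y) = z ^ 2 - Y ^ 2 by ring]
    exact h
  by_contra! hc
  obtain ⟨h1, h2⟩ := hc
  -- Here m and M are the smaller and the larger distance to ±Y. Then ‖z‖ ≤ M and δ ≤ m ≤ M, so the
  -- hypothesis gives m M ≤ (a + 1) δ M, which contradicts (a + 1) δ < m.
  have aux : ∀ m M : ℝ, (a + 1) * δ < m → m ≤ M → 2 * ‖z‖ ≤ m + M →
      m * M ≤ δ * (a * ‖z‖ + δ) → False := by
    intro m M h1 h2 h3 h4
    have e1 : δ ≤ m := by nlinarith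
    have hM : 0 < M := by nlinarith
    have e2 : δ * (a * ‖z‖ + δ) ≤ δ * ((a + 1) * M) := by
      refine mul_le_mul_of_nonneg_left ?_ hδ
      have : a * ‖z‖ ≤ a * M := mul_le_mul_of_nonneg_left (by linarith) ha
      linarith
    have e3 : (a + 1) * δ * M < m * M := mul_lt_mul_of_pos_right h1 hM
    linarith
  rcases le_total ‖z - Y‖ ‖z + Y‖ with h3 | h3
  · exact aux _ _ h1 h3 hz hp
  · exact aux _ _ h2 h3 (by linarith) (by linarith)

/-- If `F` is close to `ζ ^ 2 - Y ^ 2`, with an error which is of third order on the scale `ε`, two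
zeros of `F` on the scale `ε` nearly cancel. -/
theorem norm_add_le_of_zeros {F : ℂ → ℂ} (hF : Differentiable ℂ F) {Y z₀ z₁ : ℂ} {M N ε : ℝ}
    (hε : 0 < ε)
    (h : ∀ z : ℂ, ‖z‖ ≤ (M + 1) * ε → ‖F z - (z ^ 2 - Y ^ 2)‖ ≤ N * ε ^ 3)
    (h₀ : F z₀ = 0) (h₁ : dslope F z₀ z₁ = 0) (hz₀ : ‖z₀‖ ≤ M * ε) (hz₁ : ‖z₁‖ ≤ M * ε) :
    ‖z₀ + z₁‖ ≤ N * ε ^ 2 := by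
  set k : ℂ → ℂ := fun z => F z - (z ^ 2 - Y ^ 2) with hk
  have hkd : Differentiable ℂ k := by fun_prop
  -- Cauchy's estimate on circles of radius ε. They stay in the larger disc of radius (M + 1) ε, and
  -- one power of ε is lost.
  have hder : ∀ z ∈ Metric.closedBall (0 : ℂ) (M * ε), ‖deriv k z‖ ≤ N * ε ^ 2 := by
    intro z hz
    rw [mem_closedBall_zero_iff] at hz
    have := norm_deriv_le_of_forall_mem_sphere_norm_le hε (hkd.diffContOnCl (s := Metric.ball z ε))
      (C := N * ε ^ 3) (fun y hy => h y (by
        have h1 : ‖y - z‖ = ε := by rw [← dist_eq_norm]; exact hy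
        have h2 := norm_add_le (y - z) z
        rw [sub_add_cancel] at h2
        linarith))
    refine this.trans (le_of_eq ?_)
    field_simp
  -- For a double zero F' vanishes and k' = -2 z₁. Otherwise k z₁ - k z₀ = -(z₀ + z₁)(z₁ - z₀), and
  -- the mean value inequality lets z₁ - z₀ cancel.
  rcases eq_or_ne z₁ z₀ with rfl | hne
  · rw [dslope_same] at h₁
    have h2 : deriv k z₁ = -(z₁ + z₁) := by
      have h3 : HasDerivAt k (deriv F z₁ - (2 * z₁ - 0)) z₁ := by
        refine (hF z₁).hasDerivAt.sub (HasDerivAt.sub ?_ (hasDerivAt_const _ _))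
        simpa using hasDerivAt_pow 2 z₁
      rw [h3.deriv, h₁]
      ring
    have := hder z₁ (mem_closedBall_zero_iff.2 hz₀)
    rwa [h2, norm_neg] at this
  · have h2 : F z₁ = 0 := by rw [eq_sub_mul_dslope h₀, h₁, mul_zero]
    have h3 := (convex_closedBall (0 : ℂ) (M * ε)).norm_image_sub_le_of_norm_deriv_le
      (fun x _ => hkd x) hder (mem_closedBall_zero_iff.2 hz₀) (mem_closedBall_zero_iff.2 hz₁)
    rw [show k z₁ - k z₀ = -((z₀ + z₁) * (z₁ - z₀)) by simp only [hk, h₀, h2]; ring, norm_neg,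
      norm_mul] at h3
    exact le_of_mul_le_mul_right h3 (norm_pos_iff.2 (sub_ne_zero.2 hne))

/-- Labelling of two points, each near one of `±Y`, whose sum is small. -/
theorem exists_labelling {z₀ z₁ Y : ℂ} {a b : ℝ} (ha : 0 ≤ a)
    (h₀ : ‖z₀ - Y‖ ≤ a ∨ ‖z₀ + Y‖ ≤ a) (h₁ : ‖z₁ - Y‖ ≤ a ∨ ‖z₁ + Y‖ ≤ a) (hs : ‖z₀ + z₁‖ ≤ b) :
    (‖z₀ + Y‖ ≤ 3 * a + b ∧ ‖z₁ - Y‖ ≤ 3 * a + b) ∨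
      (‖z₁ + Y‖ ≤ 3 * a + b ∧ ‖z₀ - Y‖ ≤ 3 * a + b) := by
  have hb : 0 ≤ b := (norm_nonneg _).trans hs
  rcases h₀ with h₀ | h₀ <;> rcases h₁ with h₁ | h₁
  · left
    refine ⟨?_, by linarith⟩
    have := norm_sub_le (z₀ + z₁) (z₁ - Y)
    rw [show z₀ + z₁ - (z₁ - Y) = z₀ + Y by ring] at this
    linarith
  · right
    constructor <;> linarith
  · left
    constructor <;> linarith
  · left
    refine ⟨by linarith, ?_⟩
    have := norm_sub_le (z₀ + z₁) (z₀ + Y)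
    rw [show z₀ + z₁ - (z₀ + Y) = z₁ - Y by ring] at this
    linarith

/-- A quotient of `F` by a quadratic polynomial with small zeros has no zeros if `F` is close to
`ζ ^ 2` on a circle. -/
theorem ne_zero_of_eq_mul {F q : ℂ → ℂ} {r : ℝ} (hr : 0 < r) (hq : Differentiable ℂ q) {z₀ z₁ : ℂ}
    (hfac : ∀ z, F z = (z - z₀) * (z - z₁) * q z) (hz₀ : ‖z₀‖ ≤ r / 32) (hz₁ : ‖z₁‖ ≤ r / 32)
    (h : ∀ y : ℂ, ‖y‖ = r → ‖F y - y ^ 2‖ ≤ r ^ 2 / 8) :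
    ∀ z ∈ Metric.ball (0 : ℂ) r, q z ≠ 0 := by
  intro z hz h0
  have hr2 : 0 < r ^ 2 := by positivity
  -- On the circle F - (y - z₀)(y - z₁) is at most half as large as (y - z₀)(y - z₁), so |q - 1| ≤
  -- 1/2 there, and by the maximum principle inside.
  have key := norm_le_of_forall_mem_frontier_norm_le
    (f := fun z => q z - 1) (C := 1 / 2) (Metric.isBounded_ball (x := 0)
      (r := r)) (hq.sub_const 1).diffContOnCl (fun y hy => by
      rw [frontier_ball _ hr.ne', mem_sphere_zero_iff_norm] at hy
      have a1 : r * (7 / 8) ≤ ‖y - z₀‖ := by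
        have := norm_sub_norm_le y z₀
        linarith
      have a2 : r * (7 / 8) ≤ ‖y - z₁‖ := by
        have := norm_sub_norm_le y z₁
        linarith
      have a3 : r ^ 2 / 2 ≤ ‖(y - z₀) * (y - z₁)‖ := by
        rw [norm_mul]
        have := mul_le_mul a1 a2 (by positivity) (norm_nonneg _)
        nlinarith
      have a4 : ‖F y - (y - z₀) * (y - z₁)‖ ≤ r ^ 2 / 4 := by
        have b1 := norm_add₃_le (a := F y - y ^ 2) (b := (z₀ + z₁) * y) (c := -(z₀ * z₁))
        rw [show F y - y ^ 2 + (z₀ + z₁) * y + -(z₀ * z₁) = F y - (y - z₀) * (y - z₁) by ring,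
          norm_neg, norm_mul, norm_mul, hy] at b1
        have b2 := h y hy
        have b3 := norm_add_le z₀ z₁
        have b4 : ‖z₀‖ * ‖z₁‖ ≤ (r / 32) * (r / 32) :=
          mul_le_mul hz₀ hz₁ (norm_nonneg _) (by positivity)
        have b5 : ‖z₀ + z₁‖ * r ≤ (r / 16) * r :=
          mul_le_mul_of_nonneg_right (by linarith) hr.le
        linarith
      rw [show F y - (y - z₀) * (y - z₁) = (y - z₀) * (y - z₁) * (q y - 1) by rw [hfac y]; ring,
        norm_mul] at a4
      have a6 : r ^ 2 / 2 * ‖q y - 1‖ ≤ r ^ 2 / 4 :=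
        (mul_le_mul_of_nonneg_right a3 (norm_nonneg _)).trans a4
      refine le_of_mul_le_mul_left ?_ hr2
      linarith) (subset_closure hz)
  simp only [h0, zero_sub, norm_neg, norm_one] at key
  norm_num at key

-- Rouché-type splitting with quantitative labels. The admissible error contains no bare ε³, so
-- every zero satisfies |ζ² - Y²| ≤ δ(a|ζ| + δ) with δ of order ε². This is why the zeros are found
-- to O(ε²) without any lower bound on |Y|.
set_option maxHeartbeats 1000000 in
theorem exists_split_of_norm_sub_le {K r ε : ℝ} (hK : 1 ≤ K) (hr : 0 < r) (hrK : K * r ≤ 1 / 16)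
    (hε : 0 < ε) (hεr : K ^ 2 * ε ≤ r ^ 2 / 1000)
    {F : ℂ → ℂ} (hF : Differentiable ℂ F) {Y : ℂ} (hY : ‖Y‖ ≤ K * ε)
    (h : ∀ z : ℂ, ‖z‖ ≤ r →
      ‖F z - (z ^ 2 - Y ^ 2)‖ ≤ K * (‖z‖ ^ 3 + ε ^ 2 * ‖z‖ + ε ^ 4)) :
    ∃ z₀ z₁ : ℂ, ∃ q : ℂ → ℂ, Differentiable ℂ q ∧ (∀ z, F z = (z - z₀) * (z - z₁) * q z) ∧
      (∀ z ∈ Metric.ball (0 : ℂ) r, q z ≠ 0) ∧ z₀ ∈ Metric.ball (0 : ℂ) r ∧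
      z₁ ∈ Metric.ball (0 : ℂ) r ∧ ‖z₀ + Y‖ ≤ 50 * K ^ 4 * ε ^ 2 ∧
      ‖z₁ - Y‖ ≤ 50 * K ^ 4 * ε ^ 2 := by
  have hK2 : K ≤ K ^ 2 := by nlinarith
  have hr16 : r ≤ 1 / 16 := by nlinarith
  have hKε : K * ε ≤ r ^ 2 / 1000 := by nlinarith
  have hεr' : ε ≤ r ^ 2 / 1000 := by nlinarith
  have hr2 : r ^ 2 ≤ r / 16 := by nlinarith
  have hε1 : ε ≤ 1 := by nlinarith
  have hY2 : ‖Y ^ 2‖ ≤ K ^ 2 * ε ^ 2 := by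
    rw [norm_pow, ← mul_pow]
    exact pow_le_pow_left₀ (norm_nonneg _) hY 2
  have hε4 : K * ε ^ 4 ≤ K * ε ^ 2 := by
    have : ε ^ 4 ≤ ε ^ 2 := pow_le_pow_of_le_one hε.le hε1 (by norm_num)
    nlinarith
  have hKε2 : K * ε ^ 2 ≤ K ^ 2 * ε ^ 2 := by nlinarith [sq_nonneg ε]
  have hsmall : K ^ 2 * ε ^ 2 ≤ r ^ 2 / 1000 := by nlinarith
  -- crude bound of the error
  have h' : ∀ z : ℂ, ‖z‖ ≤ r → ‖F z - z ^ 2‖ ≤ ‖z‖ ^ 2 / 16 + 3 * (K ^ 2 * ε ^ 2) := by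
    intro z hz
    have h1 := norm_sub_le (F z - (z ^ 2 - Y ^ 2)) (Y ^ 2)
    rw [show F z - (z ^ 2 - Y ^ 2) - Y ^ 2 = F z - z ^ 2 by ring] at h1
    have h2 := h z hz
    have h3 : K * ‖z‖ ^ 3 ≤ ‖z‖ ^ 2 / 16 := by
      have : K * ‖z‖ ≤ 1 / 16 := (mul_le_mul_of_nonneg_left hz (by linarith)).trans hrK
      nlinarith [sq_nonneg ‖z‖]
    have h4 : K * (ε ^ 2 * ‖z‖) ≤ K * ε ^ 2 := by
      have : ε ^ 2 * ‖z‖ ≤ ε ^ 2 * 1 :=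
        mul_le_mul_of_nonneg_left (by linarith) (sq_nonneg ε)
      nlinarith
    linarith
  have hzero : ∀ z : ℂ, ‖z‖ ≤ r → F z = 0 → ‖z‖ ≤ 2 * K * ε := by
    intro z hz h0
    have h1 := h' z hz
    rw [h0, zero_sub, norm_neg, norm_pow] at h1
    refine abs_le_of_sq_le_sq' ?_ (by positivity) |>.2
    nlinarith
  have hsph : ∀ z ∈ Metric.sphere (0 : ℂ) r, r ^ 2 / 2 ≤ ‖F z‖ := by
    intro z hz
    rw [mem_sphere_zero_iff_norm] at hz
    have h1 := h' z hz.le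
    have h2 := norm_sub_norm_le (z ^ 2) (z ^ 2 - F z)
    rw [show z ^ 2 - (z ^ 2 - F z) = F z by ring, norm_sub_rev, norm_pow, hz] at h2
    rw [hz] at h1
    nlinarith
  obtain ⟨z₀, hz₀, hFz₀⟩ := exists_zero_of_le_norm_sphere hF hr hsph (Metric.mem_ball_self hr) (by
    have := h' 0 (by simpa using hr.le)
    simp at this
    nlinarith)
  have hz₀' := hzero z₀ (mem_ball_zero_iff.1 hz₀).le hFz₀
  -- The divided slope at z₀ itself equals F'(z₀). Its smallness supplies the interior point
  -- required for the second application of the minimum modulus principle.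
  have hderiv : ‖deriv F z₀‖ ≤ 13 * K ^ 2 * ε := by
    have := norm_deriv_le_of_forall_mem_sphere_norm_le hε
      (hF.diffContOnCl (s := Metric.ball z₀ ε)) (C := 13 * K ^ 2 * ε ^ 2) (fun y hy => by
        have h1 : ‖y - z₀‖ = ε := by rw [← dist_eq_norm]; exact hy
        have h2 := norm_add_le (y - z₀) z₀
        rw [sub_add_cancel] at h2
        have h3 : ‖y‖ ≤ 3 * K * ε := by nlinarith
        have h4 := h' y (by nlinarith)
        have h5 := norm_add_le (F y - y ^ 2) (y ^ 2)
        rw [sub_add_cancel, norm_pow] at h5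
        have h6 : ‖y‖ ^ 2 ≤ (3 * K * ε) ^ 2 := pow_le_pow_left₀ (norm_nonneg _) h3 2
        nlinarith)
    refine this.trans (le_of_eq ?_)
    field_simp
  have hG := differentiable_dslope hF z₀
  obtain ⟨z₁, hz₁, hGz₁⟩ := exists_zero_of_le_norm_sphere hG hr (m := r / 4) (fun z hz => by
    have h1 := hsph z hz
    rw [mem_sphere_zero_iff_norm] at hz
    rw [eq_sub_mul_dslope hFz₀, norm_mul] at h1
    have h2 := norm_sub_le z z₀
    have h3 := mem_ball_zero_iff.1 hz₀
    have h4 : ‖z - z₀‖ * ‖dslope F z₀ z‖ ≤ (2 * r) * ‖dslope F z₀ z‖ :=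
      mul_le_mul_of_nonneg_right (by linarith) (norm_nonneg _)
    nlinarith) hz₀ (by
    rw [dslope_same]
    nlinarith)
  have hFz₁ : F z₁ = 0 := by rw [eq_sub_mul_dslope hFz₀, hGz₁, mul_zero]
  have hz₁' := hzero z₁ (mem_ball_zero_iff.1 hz₁).le hFz₁
  have hfac : ∀ z, F z = (z - z₀) * (z - z₁) * dslope (dslope F z₀) z₁ z := fun z => by
    rw [eq_sub_mul_dslope hFz₀, eq_sub_mul_dslope hGz₁, mul_assoc]
  have hq := differentiable_dslope hG z₁
  have hqne := ne_zero_of_eq_mul hr hq hfac (by nlinarith) (by nlinarith) fun y hy => by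
    have := h' y hy.le
    rw [hy] at this
    linarith
  have hsum : ‖z₀ + z₁‖ ≤ 31 * K ^ 4 * ε ^ 2 := by
    refine norm_add_le_of_zeros hF (Y := Y) (M := 2 * K) hε (fun z hz => ?_) hFz₀ hGz₁ hz₀' hz₁'
    have h3 : ‖z‖ ≤ 3 * K * ε := by nlinarith
    refine (h z (by nlinarith)).trans ?_
    have e1 : ‖z‖ ^ 3 ≤ (3 * K * ε) ^ 3 := pow_le_pow_left₀ (norm_nonneg _) h3 3
    have e2 : ε ^ 2 * ‖z‖ ≤ ε ^ 2 * (3 * K * ε) := mul_le_mul_of_nonneg_left h3 (sq_nonneg ε)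
    have e3 : ε ^ 4 ≤ ε ^ 3 := pow_le_pow_of_le_one hε.le hε1 (by norm_num)
    have e4 : (1 : ℝ) ≤ K ^ 2 := by nlinarith
    have e5 : K ≤ K ^ 3 := by nlinarith
    have e6 : (1 : ℝ) ≤ K ^ 3 := by linarith
    have e7 : 0 < ε ^ 3 := by positivity
    calc K * (‖z‖ ^ 3 + ε ^ 2 * ‖z‖ + ε ^ 4)
        ≤ K * ((3 * K * ε) ^ 3 + ε ^ 2 * (3 * K * ε) + ε ^ 3) := by gcongr
      _ = K * (27 * K ^ 3 + 3 * K + 1) * ε ^ 3 := by ring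
      _ ≤ K * (31 * K ^ 3) * ε ^ 3 := by gcongr; linarith
      _ = 31 * K ^ 4 * ε ^ 3 := by ring
  have hdist : ∀ z : ℂ, ‖z‖ ≤ r → F z = 0 →
      ‖z - Y‖ ≤ 6 * K ^ 4 * ε ^ 2 ∨ ‖z + Y‖ ≤ 6 * K ^ 4 * ε ^ 2 := by
    intro z hz h0
    have hz' := hzero z hz h0
    have h1 := h z hz
    rw [h0, zero_sub, norm_neg] at h1
    have e1 : ‖z‖ ^ 2 ≤ (2 * K * ε) ^ 2 := pow_le_pow_left₀ (norm_nonneg _) hz' 2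
    have e2 : ‖z‖ ^ 3 ≤ (2 * K * ε) ^ 2 * ‖z‖ := by
      rw [pow_succ]
      exact mul_le_mul_of_nonneg_right e1 (norm_nonneg _)
    -- At a zero ‖z‖ = O(ε), so ‖z‖³ is absorbed into ε²‖z‖. The bound now has the form δ(a‖z‖ + δ)
    -- with δ = K ε² and a = 4K² + 1.
    have e3 : ‖z ^ 2 - Y ^ 2‖ ≤ (K * ε ^ 2) * ((4 * K ^ 2 + 1) * ‖z‖ + K * ε ^ 2) := by
      refine h1.trans ?_
      calc K * (‖z‖ ^ 3 + ε ^ 2 * ‖z‖ + ε ^ 4)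
          ≤ K * ((2 * K * ε) ^ 2 * ‖z‖ + ε ^ 2 * ‖z‖ + K * ε ^ 4) := by
            gcongr
            nlinarith [pow_pos hε 4]
        _ = _ := by ring
    have e4 : (4 * K ^ 2 + 1 + 1) * (K * ε ^ 2) ≤ 6 * K ^ 4 * ε ^ 2 := by
      have : (4 * K ^ 2 + 1 + 1) * K ≤ 6 * K ^ 4 := by
        have : (1 : ℝ) ≤ K ^ 2 := by nlinarith
        have : K ^ 3 ≤ K ^ 4 := pow_le_pow_right₀ hK (by norm_num)
        have : K ≤ K ^ 3 := by nlinarith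
        nlinarith
      nlinarith [sq_nonneg ε]
    rcases norm_sub_le_or_norm_add_le (by positivity) (by positivity) e3 with h2 | h2
    · exact Or.inl (h2.trans e4)
    · exact Or.inr (h2.trans e4)
  have hlab := exists_labelling (by positivity) (hdist z₀ (mem_ball_zero_iff.1 hz₀).le hFz₀)
    (hdist z₁ (mem_ball_zero_iff.1 hz₁).le hFz₁) hsum
  have hfin : 3 * (6 * K ^ 4 * ε ^ 2) + 31 * K ^ 4 * ε ^ 2 ≤ 50 * K ^ 4 * ε ^ 2 := by
    nlinarith [show 0 ≤ K ^ 4 * ε ^ 2 by positivity]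
  rcases hlab with ⟨h1, h2⟩ | ⟨h1, h2⟩
  · exact ⟨z₀, z₁, _, hq, hfac, hqne, hz₀, hz₁, h1.trans hfin, h2.trans hfin⟩
  · exact ⟨z₁, z₀, _, hq, fun z => by rw [hfac z]; ring, hqne, hz₁, hz₀, h1.trans hfin,
      h2.trans hfin⟩

/-! ### Second-order expansion of a matrix differential equation -/

section MatrixODE

attribute [local instance] Matrix.linftyOpNormedAddCommGroup Matrix.linftyOpNormedSpace
  Matrix.linftyOpNormedRing Matrix.linftyOpNormedAlgebra

theorem norm_entry_le (M : Matrix (Fin 2) (Fin 2) ℂ) (i j : Fin 2) : ‖M i j‖ ≤ ‖M‖ := by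
  rw [Matrix.linfty_opNorm_def]
  have h1 : ‖M i j‖₊ ≤ ∑ j : Fin 2, ‖M i j‖₊ :=
    Finset.single_le_sum (f := fun j => ‖M i j‖₊) (fun _ _ => zero_le) (Finset.mem_univ j)
  have h2 : ∑ j : Fin 2, ‖M i j‖₊ ≤ Finset.univ.sup fun i : Fin 2 => ∑ j : Fin 2, ‖M i j‖₊ :=
    Finset.le_sup (f := fun i : Fin 2 => ∑ j : Fin 2, ‖M i j‖₊) (Finset.mem_univ i)
  exact_mod_cast h1.trans h2

theorem norm_le_of_entry_le {M : Matrix (Fin 2) (Fin 2) ℂ} {B : ℝ} (hB : 0 ≤ B)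
    (h : ∀ i j, ‖M i j‖ ≤ B) : ‖M‖ ≤ 2 * B := by
  rw [Matrix.linfty_opNorm_def]
  lift B to NNReal using hB
  have : (Finset.univ.sup fun i : Fin 2 => ∑ j : Fin 2, ‖M i j‖₊) ≤ 2 * B := by
    refine Finset.sup_le fun i _ => ?_
    rw [Fin.sum_univ_two, two_mul]
    exact add_le_add (by exact_mod_cast h i 0) (by exact_mod_cast h i 1)
  exact_mod_cast this

theorem hasDerivAt_matrix {Y : ℝ → Matrix (Fin 2) (Fin 2) ℂ} {Y' : Matrix (Fin 2) (Fin 2) ℂ}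
    {x : ℝ} : HasDerivAt Y Y' x ↔ ∀ i j, HasDerivAt (fun y => Y y i j) (Y' i j) x :=
  ⟨fun h i j => hasDerivAt_pi.1 (hasDerivAt_pi.1 h i) j,
    fun h => hasDerivAt_pi.2 fun i => hasDerivAt_pi.2 fun j => h i j⟩

theorem exists_primitive {V : ℝ → Matrix (Fin 2) (Fin 2) ℂ} (hV : Continuous V) :
    ∃ N : ℝ → Matrix (Fin 2) (Fin 2) ℂ, N 0 = 0 ∧ ∀ x, HasDerivAt N (V x) x :=
  ⟨fun x => ∫ y in (0 : ℝ)..x, V y, by simp, fun x => hV.integral_hasStrictDerivAt 0 x |>.hasDerivAt⟩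

variable {L : ℝ}

/-- Each remainder Y - 1, Y - 1 - N, … of the Picard expansion has derivative W times the preceding
one, so one use of this bound gains a factor ρ L. Grönwall's inequality for Y starts the chain. -/
theorem norm_le_of_hasDerivAt_mul {Z W V : ℝ → Matrix (Fin 2) (Fin 2) ℂ} {ρ B : ℝ} (hρ : 0 ≤ ρ)
    (h0 : Z 0 = 0) (hZ : ∀ x ∈ Set.Icc 0 L, HasDerivAt Z (W x * V x) x)
    (hW : ∀ x ∈ Set.Icc 0 L, ‖W x‖ ≤ ρ) (hV : ∀ x ∈ Set.Icc 0 L, ‖V x‖ ≤ B) {x : ℝ}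
    (hx : x ∈ Set.Icc 0 L) : ‖Z x‖ ≤ ρ * B * L := by
  have hB : 0 ≤ B := (norm_nonneg _).trans (hV x hx)
  have := norm_image_sub_le_of_norm_deriv_le_segment' (f := Z) (f' := fun x => W x * V x)
    (C := ρ * B) (fun y hy => (hZ y hy).hasDerivWithinAt)
    (fun y hy => (norm_mul_le _ _).trans
      (mul_le_mul (hW y ⟨hy.1, hy.2.le⟩) (hV y ⟨hy.1, hy.2.le⟩) (norm_nonneg _) hρ)) x hx
  rw [h0, sub_zero, sub_zero] at this
  exact this.trans (mul_le_mul_of_nonneg_left hx.2 (by positivity))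

theorem norm_le_exp_of_hasDerivAt {Y W : ℝ → Matrix (Fin 2) (Fin 2) ℂ} {ρ : ℝ} (hρ : 0 ≤ ρ)
    (hY : ∀ x ∈ Set.Icc 0 L, HasDerivAt Y (W x * Y x) x)
    (hW : ∀ x ∈ Set.Icc 0 L, ‖W x‖ ≤ ρ) {x : ℝ}
    (hx : x ∈ Set.Icc 0 L) : ‖Y x‖ ≤ ‖Y 0‖ * Real.exp (ρ * L) := by
  have := norm_le_gronwallBound_of_norm_deriv_right_le (f := Y) (f' := fun x => W x * Y x)
    (δ := ‖Y 0‖) (K := ρ) (ε := 0) (a := 0) (b := L)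
    (fun y hy => (hY y hy).continuousAt.continuousWithinAt)
    (fun y hy => (hY y ⟨hy.1, hy.2.le⟩).hasDerivWithinAt) le_rfl (fun y hy => by
      rw [add_zero]
      exact (norm_mul_le _ _).trans
        (mul_le_mul_of_nonneg_right (hW y ⟨hy.1, hy.2.le⟩) (norm_nonneg _))) x hx
  rw [gronwallBound_ε0, sub_zero] at this
  refine this.trans ?_
  have := hx.2
  gcongr

/-- First-order expansion of the solution of `Y' = W Y`, `Y 0 = 1`, for small `W`. -/
theorem norm_sub_one_sub_le {Y W N : ℝ → Matrix (Fin 2) (Fin 2) ℂ} {ρ : ℝ} (hρ : 0 ≤ ρ)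
    (hY0 : Y 0 = 1) (hY : ∀ x ∈ Set.Icc 0 L, HasDerivAt Y (W x * Y x) x)
    (hW : ∀ x ∈ Set.Icc 0 L, ‖W x‖ ≤ ρ) (hN0 : N 0 = 0)
    (hN : ∀ x ∈ Set.Icc 0 L, HasDerivAt N (W x) x) {x : ℝ}
    (hx : x ∈ Set.Icc 0 L) :
    ‖Y x - 1 - N x‖ ≤ ρ * (ρ * (‖(1 : Matrix (Fin 2) (Fin 2) ℂ)‖ * Real.exp (ρ * L)) * L) * L := by
  have h1 : ∀ y ∈ Set.Icc 0 L,
      ‖Y y - 1‖ ≤ ρ * (‖(1 : Matrix (Fin 2) (Fin 2) ℂ)‖ * Real.exp (ρ * L)) * L := fun y hy =>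
    norm_le_of_hasDerivAt_mul (Z := fun y => Y y - 1) hρ (by simp [hY0])
      (fun z hz => (hY z hz).sub_const 1) hW
      (fun z hz => by simpa [hY0] using norm_le_exp_of_hasDerivAt hρ hY hW hz) hy
  exact norm_le_of_hasDerivAt_mul (Z := fun y => Y y - 1 - N y) (V := fun y => Y y - 1) hρ
    (by simp [hY0, hN0]) (fun z hz => by
      have := ((hY z hz).sub_const 1).sub (hN z hz)
      rwa [show W z * Y z - W z = W z * (Y z - 1) by noncomm_ring] at this) hW h1 hx

/-- Second-order expansion of the solution of `Y' = W Y`, `Y 0 = 1`, for small `W`. -/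
theorem norm_sub_one_sub_sub_le {Y W N N' : ℝ → Matrix (Fin 2) (Fin 2) ℂ} {ρ : ℝ} (hρ : 0 ≤ ρ)
    (hY0 : Y 0 = 1) (hY : ∀ x ∈ Set.Icc 0 L, HasDerivAt Y (W x * Y x) x)
    (hW : ∀ x ∈ Set.Icc 0 L, ‖W x‖ ≤ ρ) (hN0 : N 0 = 0)
    (hN : ∀ x ∈ Set.Icc 0 L, HasDerivAt N (W x) x) (hN'0 : N' 0 = 0)
    (hN' : ∀ x ∈ Set.Icc 0 L, HasDerivAt N' (W x * N x) x) {x : ℝ}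
    (hx : x ∈ Set.Icc 0 L) :
    ‖Y x - 1 - N x - N' x‖ ≤ ρ *
      (ρ * (ρ * (‖(1 : Matrix (Fin 2) (Fin 2) ℂ)‖ * Real.exp (ρ * L)) * L) * L) * L :=
  norm_le_of_hasDerivAt_mul (Z := fun y => Y y - 1 - N y - N' y) (V := fun y => Y y - 1 - N y) hρ
    (by simp [hY0, hN0, hN'0]) (fun z hz => by
      have := (((hY z hz).sub_const 1).sub (hN z hz)).sub (hN' z hz)
      rwa [show W z * Y z - W z - W z * N z = W z * (Y z - 1 - N z) by noncomm_ring] at this) hW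
    (fun _ hy => norm_sub_one_sub_le hρ hY0 hY hW hN0 hN hy) hx

/-- The polarization of the determinant of a `2 × 2` matrix. -/
def mixedDet (A B : Matrix (Fin 2) (Fin 2) ℂ) : ℂ :=
  A 0 0 * B 1 1 + A 1 1 * B 0 0 - A 0 1 * B 1 0 - A 1 0 * B 0 1

theorem norm_mixedDet_le {A B : Matrix (Fin 2) (Fin 2) ℂ} {a b : ℝ} (hA : ‖A‖ ≤ a)
    (hB : ‖B‖ ≤ b) : ‖mixedDet A B‖ ≤ 4 * (a * b) := by
  have ha : 0 ≤ a := (norm_nonneg _).trans hA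
  have h : ∀ i j k l, ‖A i j * B k l‖ ≤ a * b := fun i j k l => by
    rw [norm_mul]
    exact mul_le_mul ((norm_entry_le A i j).trans hA) ((norm_entry_le B k l).trans hB)
      (norm_nonneg _) ha
  have h1 := norm_sub_le (A 0 0 * B 1 1 + A 1 1 * B 0 0 - A 0 1 * B 1 0) (A 1 0 * B 0 1)
  have h2 := norm_sub_le (A 0 0 * B 1 1 + A 1 1 * B 0 0) (A 0 1 * B 1 0)
  have h3 := norm_add_le (A 0 0 * B 1 1) (A 1 1 * B 0 0)
  have := h 0 0 1 1
  have := h 1 1 0 0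
  have := h 0 1 1 0
  have := h 1 0 0 1
  unfold mixedDet
  linarith

theorem norm_det_le {A : Matrix (Fin 2) (Fin 2) ℂ} {a : ℝ} (hA : ‖A‖ ≤ a) :
    ‖A.det‖ ≤ 2 * (a * a) := by
  have h := norm_mixedDet_le hA hA
  rw [show mixedDet A A = 2 * A.det by rw [Matrix.det_fin_two, mixedDet]; ring, norm_mul,
    Complex.norm_two] at h
  linarith

/-- The determinant is a quadratic form with polarization `mixedDet`. With A, B and the remainder of
orders 1, 2 and 3, all terms other than det A and the A, B cross term have order at least 4. The
constant is 2 + 4 + 8 + 8, using ρ ≤ 2 for the orders 5 and 6. -/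
theorem norm_det_sub_le {X A B : Matrix (Fin 2) (Fin 2) ℂ} {c ρ : ℝ} (hρ : 0 ≤ ρ)
    (hρ2 : ρ ≤ 2) (hA : ‖A‖ ≤ c * ρ) (hB : ‖B‖ ≤ c * ρ ^ 2) (hX : ‖X - A - B‖ ≤ c * ρ ^ 3) :
    ‖X.det - (A.det + mixedDet A B)‖ ≤ 22 * c ^ 2 * ρ ^ 4 := by
  set R := X - A - B with hR
  have hXe : X = A + B + R := by rw [hR]; abel
  have e : X.det - (A.det + mixedDet A B) = B.det + mixedDet A R + mixedDet B R + R.det := by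
    rw [hXe]
    simp only [Matrix.det_fin_two, mixedDet, Matrix.add_apply]
    ring
  rw [e]
  have h1 := norm_det_le hB
  have h2 := norm_mixedDet_le hA hX
  have h3 := norm_mixedDet_le hB hX
  have h4 := norm_det_le hX
  have h5 := norm_add_le (B.det + mixedDet A R + mixedDet B R) R.det
  have h6 := norm_add₃_le (a := B.det) (b := mixedDet A R) (c := mixedDet B R)
  have h7 : c ^ 2 * ρ ^ 5 ≤ c ^ 2 * ρ ^ 4 * 2 := by
    rw [pow_succ ρ 4, ← mul_assoc]
    exact mul_le_mul_of_nonneg_left hρ2 (by positivity)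
  have h8 : c ^ 2 * ρ ^ 6 ≤ c ^ 2 * ρ ^ 5 * 2 := by
    rw [pow_succ ρ 5, ← mul_assoc]
    exact mul_le_mul_of_nonneg_left hρ2 (by positivity)
  nlinarith

set_option maxHeartbeats 1000000 in
/-- Expansion of `det (Y L - 1)`, averaged over the sign of `t`, for `Y' = (ζ V₁ + t V₂) Y`. -/
theorem exists_det_expansion (hL : 0 < L) (K : ℝ) (hK : 0 ≤ K) : ∃ C : ℝ, 0 ≤ C ∧
    ∀ V₁ V₂ N₁ N₂ : ℝ → Matrix (Fin 2) (Fin 2) ℂ, Continuous V₁ → Continuous V₂ →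
    (∀ x, ‖V₁ x‖ ≤ K) → (∀ x, ‖V₂ x‖ ≤ K) → N₁ 0 = 0 → N₂ 0 = 0 →
    (∀ x, HasDerivAt N₁ (V₁ x) x) → (∀ x, HasDerivAt N₂ (V₂ x) x) →
    ∀ (ζ : ℂ) (t : ℝ), ‖ζ‖ ≤ 1 → 0 ≤ t → t ≤ 1 →
    ∀ Y Y' : ℝ → Matrix (Fin 2) (Fin 2) ℂ, Y 0 = 1 → Y' 0 = 1 →
    (∀ x, HasDerivAt Y ((ζ • V₁ x + (t : ℂ) • V₂ x) * Y x) x) →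
    (∀ x, HasDerivAt Y' ((ζ • V₁ x + (-t : ℂ) • V₂ x) * Y' x) x) →
    ‖(Y L - 1).det + (Y' L - 1).det - 2 * (ζ ^ 2 * (N₁ L).det + (t : ℂ) ^ 2 * (N₂ L).det)‖ ≤
      C * (‖ζ‖ ^ 3 + t ^ 2 * ‖ζ‖ + t ^ 4) := by
  set o : ℝ := ‖(1 : Matrix (Fin 2) (Fin 2) ℂ)‖ with ho
  set c₁ : ℝ := K * o * L with hc₁
  set c₂ : ℝ := K * c₁ * L with hc₂
  set c₃ : ℝ := K * (K * (K * (o * Real.exp (2 * K * L)) * L) * L) * L with hc₃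
  have ho0 : 0 ≤ o := norm_nonneg _
  have hc₁0 : 0 ≤ c₁ := by positivity
  have hc₂0 : 0 ≤ c₂ := by positivity
  have hc₃0 : 0 ≤ c₃ := by positivity
  set c : ℝ := c₁ + c₂ + c₃ with hc
  -- 352 = 2 · 22 · 8: two remainders 22 c² ρ⁴, with ρ⁴ ≤ 8(‖ζ‖³ + t⁴). The other summand covers the
  -- cubic terms that survive the averaging.
  refine ⟨352 * c ^ 2 + 24 * (c₁ * (2 * c₂)), by positivity, ?_⟩
  intro V₁ V₂ N₁ N₂ hV₁ hV₂ hV₁K hV₂K hN₁0 hN₂0 hN₁ hN₂ ζ t hζ ht0 ht1 Y Y' hY0 hY'0 hY hY'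
  have hN₁c : Continuous N₁ := continuous_iff_continuousAt.2 fun x => (hN₁ x).continuousAt
  have hN₂c : Continuous N₂ := continuous_iff_continuousAt.2 fun x => (hN₂ x).continuousAt
  obtain ⟨P, hP0, hP⟩ := exists_primitive (hV₁.mul hN₁c)
  obtain ⟨Q₁, hQ₁0, hQ₁⟩ := exists_primitive (hV₁.mul hN₂c)
  obtain ⟨Q₂, hQ₂0, hQ₂⟩ := exists_primitive (hV₂.mul hN₁c)
  obtain ⟨R, hR0, hR⟩ := exists_primitive (hV₂.mul hN₂c)
  have hLL : L ∈ Set.Icc 0 L := ⟨hL.le, le_rfl⟩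
  have bN₁ : ∀ x ∈ Set.Icc 0 L, ‖N₁ x‖ ≤ c₁ := fun x hx =>
    norm_le_of_hasDerivAt_mul (V := fun _ => 1) hK hN₁0 (fun y _ => by simpa using hN₁ y)
      (fun y _ => hV₁K y) (fun _ _ => le_rfl) hx
  have bN₂ : ∀ x ∈ Set.Icc 0 L, ‖N₂ x‖ ≤ c₁ := fun x hx =>
    norm_le_of_hasDerivAt_mul (V := fun _ => 1) hK hN₂0 (fun y _ => by simpa using hN₂ y)
      (fun y _ => hV₂K y) (fun _ _ => le_rfl) hx
  have bP : ‖P L‖ ≤ c₂ :=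
    norm_le_of_hasDerivAt_mul hK hP0 (fun y _ => hP y) (fun y _ => hV₁K y) bN₁ hLL
  have bQ₁ : ‖Q₁ L‖ ≤ c₂ :=
    norm_le_of_hasDerivAt_mul hK hQ₁0 (fun y _ => hQ₁ y) (fun y _ => hV₁K y) bN₂ hLL
  have bQ₂ : ‖Q₂ L‖ ≤ c₂ :=
    norm_le_of_hasDerivAt_mul hK hQ₂0 (fun y _ => hQ₂ y) (fun y _ => hV₂K y) bN₁ hLL
  have bR : ‖R L‖ ≤ c₂ :=
    norm_le_of_hasDerivAt_mul hK hR0 (fun y _ => hR y) (fun y _ => hV₂K y) bN₂ hLL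
  set ρ : ℝ := ‖ζ‖ + t with hρ
  have hρ0 : 0 ≤ ρ := by positivity
  have hρ2 : ρ ≤ 2 := by linarith
  have key : ∀ (τ : ℂ) (X : ℝ → Matrix (Fin 2) (Fin 2) ℂ), ‖τ‖ = t → X 0 = 1 →
      (∀ x, HasDerivAt X ((ζ • V₁ x + τ • V₂ x) * X x) x) →
      ‖(X L - 1).det - ((ζ • N₁ L + τ • N₂ L).det + mixedDet (ζ • N₁ L + τ • N₂ L)
        (ζ ^ 2 • P L + (ζ * τ) • (Q₁ L + Q₂ L) + τ ^ 2 • R L))‖ ≤ 22 * c ^ 2 * ρ ^ 4 := by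
    intro τ X hτ hX0 hX
    have hW : ∀ x ∈ Set.Icc 0 L, ‖ζ • V₁ x + τ • V₂ x‖ ≤ ρ * K := fun x _ => by
      refine (norm_add_le _ _).trans ?_
      rw [norm_smul, norm_smul, hτ, hρ, add_mul]
      exact add_le_add (mul_le_mul_of_nonneg_left (hV₁K x) (norm_nonneg _))
        (mul_le_mul_of_nonneg_left (hV₂K x) ht0)
    set M : ℝ → Matrix (Fin 2) (Fin 2) ℂ := fun x => ζ • N₁ x + τ • N₂ x with hM
    set M' : ℝ → Matrix (Fin 2) (Fin 2) ℂ :=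
      fun x => ζ ^ 2 • P x + (ζ * τ) • (Q₁ x + Q₂ x) + τ ^ 2 • R x with hM'
    have hN0 : M 0 = 0 := by simp [hM, hN₁0, hN₂0]
    have hN : ∀ x, HasDerivAt M (ζ • V₁ x + τ • V₂ x) x := fun x =>
      ((hN₁ x).const_smul ζ).add ((hN₂ x).const_smul τ)
    have hN'0 : M' 0 = 0 := by simp [hM', hP0, hQ₁0, hQ₂0, hR0]
    have hN' : ∀ x, HasDerivAt M' ((ζ • V₁ x + τ • V₂ x) * M x) x := fun x => by
      have := (((hP x).const_smul (ζ ^ 2)).add (((hQ₁ x).add (hQ₂ x)).const_smul (ζ * τ))).add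
        ((hR x).const_smul (τ ^ 2))
      refine this.congr_deriv ?_
      simp only [hM, Pi.mul_apply, add_mul, mul_add, smul_mul_smul_comm, smul_add, sq,
        mul_comm τ ζ]
      abel
    have bM : ∀ x ∈ Set.Icc 0 L, ‖M x‖ ≤ ρ * K * o * L := fun x hx =>
      norm_le_of_hasDerivAt_mul (Z := M) (V := fun _ => 1) (by positivity) hN0
        (fun y _ => by simpa using hN y) hW (fun _ _ => le_rfl) hx
    have bM' : ‖M' L‖ ≤ ρ * K * (ρ * K * o * L) * L :=
      norm_le_of_hasDerivAt_mul (Z := M') (V := M) (by positivity) hN'0 (fun y _ => hN' y) hW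
        bM hLL
    have bX := norm_sub_one_sub_sub_le (by positivity) hX0 (fun y _ => hX y) hW hN0
        (fun y _ => hN y) hN'0 (fun y _ => hN' y) hLL
    have hexp : Real.exp (ρ * K * L) ≤ Real.exp (2 * K * L) := by gcongr
    refine norm_det_sub_le (A := M L) (B := M' L) hρ0 hρ2 (bM L hLL |>.trans ?_) (bM'.trans ?_)
      (bX.trans ?_)
    · calc ρ * K * o * L = c₁ * ρ := by rw [hc₁]; ring
        _ ≤ c * ρ := by gcongr; linarith
    · calc ρ * K * (ρ * K * o * L) * L = c₂ * ρ ^ 2 := by rw [hc₂, hc₁]; ring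
        _ ≤ c * ρ ^ 2 := by gcongr; linarith
    · calc _ = K * (K * (K * (o * Real.exp (ρ * K * L)) * L) * L) * L * ρ ^ 3 := by ring
        _ ≤ c₃ * ρ ^ 3 := by rw [hc₃]; gcongr
        _ ≤ c * ρ ^ 3 := by gcongr; linarith
  have k₁ := key t Y (by simp [abs_of_nonneg ht0]) hY0 hY
  have k₂ := key (-t) Y' (by simp [abs_of_nonneg ht0]) hY'0 hY'
  set u₁ := (Y L - 1).det - ((ζ • N₁ L + (t : ℂ) • N₂ L).det + mixedDet (ζ • N₁ L + (t : ℂ) • N₂ L)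
        (ζ ^ 2 • P L + (ζ * t) • (Q₁ L + Q₂ L) + (t : ℂ) ^ 2 • R L)) with hu₁
  set u₂ := (Y' L - 1).det - ((ζ • N₁ L + (-t : ℂ) • N₂ L).det +
        mixedDet (ζ • N₁ L + (-t : ℂ) • N₂ L)
        (ζ ^ 2 • P L + (ζ * -t) • (Q₁ L + Q₂ L) + (-t : ℂ) ^ 2 • R L)) with hu₂
  -- Adding the expansions for t and -t cancels everything odd in t: the ζt term, the ζ²t terms and
  -- above all t³. Among the cubic terms only ζ³ and t²ζ remain.
  have e : (Y L - 1).det + (Y' L - 1).det -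
      2 * (ζ ^ 2 * (N₁ L).det + (t : ℂ) ^ 2 * (N₂ L).det) =
      u₁ + u₂ + (2 * ζ ^ 3 * mixedDet (N₁ L) (P L) + 2 * ((t : ℂ) ^ 2 * ζ) *
        (mixedDet (N₁ L) (R L) + mixedDet (N₂ L) (Q₁ L + Q₂ L))) := by
    rw [hu₁, hu₂]
    simp only [Matrix.det_fin_two, mixedDet, Matrix.add_apply, Matrix.smul_apply, smul_eq_mul]
    ring
  rw [e]
  have m₁ := norm_mixedDet_le (bN₁ L hLL) bP
  have m₂ := norm_mixedDet_le (bN₁ L hLL) bR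
  have m₃ := norm_mixedDet_le (bN₂ L hLL)
    ((norm_add_le _ _).trans (add_le_add bQ₁ bQ₂))
  have m₄ : ‖2 * ζ ^ 3 * mixedDet (N₁ L) (P L)‖ ≤ 2 * ‖ζ‖ ^ 3 * (4 * (c₁ * c₂)) := by
    rw [norm_mul, norm_mul, norm_pow, Complex.norm_two]
    gcongr
  have m₅ : ‖2 * ((t : ℂ) ^ 2 * ζ) * (mixedDet (N₁ L) (R L) + mixedDet (N₂ L) (Q₁ L + Q₂ L))‖ ≤
      2 * (t ^ 2 * ‖ζ‖) * (4 * (c₁ * c₂) + 4 * (c₁ * (c₂ + c₂))) := by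
    rw [norm_mul, norm_mul, norm_mul, norm_pow, Complex.norm_two, norm_real, Real.norm_eq_abs,
      sq_abs]
    gcongr
    exact (norm_add_le _ _).trans (add_le_add m₂ m₃)
  have hρ4 : ρ ^ 4 ≤ 8 * (‖ζ‖ ^ 3 + t ^ 4) := by
    have h1 : ρ ^ 4 ≤ 8 * (‖ζ‖ ^ 4 + t ^ 4) := by
      have a := sq_nonneg (‖ζ‖ - t)
      have b := sq_nonneg (‖ζ‖ ^ 2 - t ^ 2)
      have h2 : ρ ^ 2 ≤ 2 * (‖ζ‖ ^ 2 + t ^ 2) := by rw [hρ]; nlinarith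
      calc ρ ^ 4 = (ρ ^ 2) ^ 2 := by ring
        _ ≤ (2 * (‖ζ‖ ^ 2 + t ^ 2)) ^ 2 := by gcongr
        _ ≤ _ := by nlinarith
    have h2 : ‖ζ‖ ^ 4 ≤ ‖ζ‖ ^ 3 := pow_le_pow_of_le_one (norm_nonneg _) hζ (by norm_num)
    linarith
  have f₁ := norm_add₃_le (a := u₁) (b := u₂) (c := 2 * ζ ^ 3 * mixedDet (N₁ L) (P L) +
    2 * ((t : ℂ) ^ 2 * ζ) * (mixedDet (N₁ L) (R L) + mixedDet (N₂ L) (Q₁ L + Q₂ L)))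
  have f₂ := norm_add_le (2 * ζ ^ 3 * mixedDet (N₁ L) (P L))
    (2 * ((t : ℂ) ^ 2 * ζ) * (mixedDet (N₁ L) (R L) + mixedDet (N₂ L) (Q₁ L + Q₂ L)))
  have f₃ : 22 * c ^ 2 * ρ ^ 4 ≤ 22 * c ^ 2 * (8 * (‖ζ‖ ^ 3 + t ^ 4)) := by gcongr
  have g₁ : 0 ≤ c ^ 2 * (t ^ 2 * ‖ζ‖) := by positivity
  have g₂ : 0 ≤ c₁ * c₂ * t ^ 4 := by positivity
  have g₃ : 0 ≤ c₁ * c₂ * ‖ζ‖ ^ 3 := by positivity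
  have g₄ : 0 ≤ c₁ * c₂ * (t ^ 2 * ‖ζ‖) := by positivity
  nlinarith

end MatrixODE

section Monodromy

attribute [local instance] Matrix.linftyOpNormedAddCommGroup Matrix.linftyOpNormedSpace
  Matrix.linftyOpNormedRing Matrix.linftyOpNormedAlgebra

/-! ### Traceless linear systems -/

/-- For 2 × 2 matrices the adjugate is linear, and adj U = -U when U is traceless, so adj(UΨ) =
-adj(Ψ) U. -/
theorem hasDerivAt_adjugate {Ψ : ℝ → Matrix (Fin 2) (Fin 2) ℂ} {U : Matrix (Fin 2) (Fin 2) ℂ}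
    {x : ℝ} (hU : U 1 1 = -U 0 0) (h : HasDerivAt Ψ (U * Ψ x) x) :
    HasDerivAt (fun y => (Ψ y).adjugate) (-((Ψ x).adjugate * U)) x := by
  have h' := hasDerivAt_matrix.1 h
  refine hasDerivAt_matrix.2 fun i j => ?_
  have h00 := h' 0 0
  have h01 := h' 0 1
  have h10 := h' 1 0
  have h11 := h' 1 1
  fin_cases i <;> fin_cases j <;>
    simp only [Matrix.adjugate_fin_two, Matrix.mul_apply, Fin.sum_univ_two, Fin.zero_eta,
      Fin.mk_one, Matrix.of_apply, Matrix.cons_val', Matrix.cons_val_zero, Matrix.cons_val_one,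
      Matrix.cons_val_fin_one, Matrix.neg_apply, hU, Fin.isValue] at h00 h01 h10 h11 ⊢
  · exact h11.congr_deriv (by ring)
  · exact h01.neg.congr_deriv (by ring)
  · exact h10.neg.congr_deriv (by ring)
  · exact h00.congr_deriv (by ring)

/-- The derivatives of the two factors cancel. This conserved product yields det Ψ = 1, the inverse
of Ψ, and the expression of every solution through Ψ. -/
theorem adjugate_mul_eq {Ψ Φ U : ℝ → Matrix (Fin 2) (Fin 2) ℂ} (hU : ∀ x, U x 1 1 = -U x 0 0)
    (hΨ : ∀ x, HasDerivAt Ψ (U x * Ψ x) x) (hΦ : ∀ x, HasDerivAt Φ (U x * Φ x) x) (x : ℝ) :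
    (Ψ x).adjugate * Φ x = (Ψ 0).adjugate * Φ 0 := by
  have h : ∀ x, HasDerivAt (fun x => (Ψ x).adjugate * Φ x) 0 x := fun x =>
    ((hasDerivAt_adjugate (hU x) (hΨ x)).mul (hΦ x)).congr_deriv (by noncomm_ring)
  exact is_const_of_deriv_eq_zero (fun x => (h x).differentiableAt) (fun x => (h x).deriv) x 0

theorem zsMatrix_traceless (u : ℝ → ℂ) (z : ℂ) (x : ℝ) :
    zsMatrix u z x 1 1 = -zsMatrix u z x 0 0 := by
  simp [zsMatrix]

theorem IsFundamental.hasDerivAt {u : ℝ → ℂ} {z : ℂ} {Ψ : ℝ → Matrix (Fin 2) (Fin 2) ℂ}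
    (h : IsFundamental u z Ψ) (x : ℝ) : HasDerivAt Ψ (zsMatrix u z x * Ψ x) x :=
  hasDerivAt_matrix.2 fun i j => h.deriv x i j

theorem IsFundamental.adjugate_mul_self {u : ℝ → ℂ} {z : ℂ} {Ψ : ℝ → Matrix (Fin 2) (Fin 2) ℂ}
    (h : IsFundamental u z Ψ) (x : ℝ) : (Ψ x).adjugate * Ψ x = 1 := by
  rw [adjugate_mul_eq (zsMatrix_traceless u z) h.hasDerivAt h.hasDerivAt x, h.init]
  simp

theorem IsFundamental.mul_adjugate_self {u : ℝ → ℂ} {z : ℂ} {Ψ : ℝ → Matrix (Fin 2) (Fin 2) ℂ}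
    (h : IsFundamental u z Ψ) (x : ℝ) : Ψ x * (Ψ x).adjugate = 1 :=
  mul_eq_one_comm.1 (h.adjugate_mul_self x)

theorem IsFundamental.det_eq_one {u : ℝ → ℂ} {z : ℂ} {Ψ : ℝ → Matrix (Fin 2) (Fin 2) ℂ}
    (h : IsFundamental u z Ψ) (x : ℝ) : (Ψ x).det = 1 := by
  have := h.adjugate_mul_self x
  rw [Matrix.adjugate_mul] at this
  simpa using congrFun (congrFun this 0) 0

theorem IsFundamental.eq_mul {u : ℝ → ℂ} {z : ℂ} {Ψ Φ : ℝ → Matrix (Fin 2) (Fin 2) ℂ}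
    (h : IsFundamental u z Ψ) (hΦ : ∀ x, HasDerivAt Φ (zsMatrix u z x * Φ x) x) (x : ℝ) :
    Φ x = Ψ x * Φ 0 := by
  have := adjugate_mul_eq (zsMatrix_traceless u z) h.hasDerivAt hΦ x
  rw [h.init, Matrix.adjugate_one, one_mul] at this
  rw [← this, ← mul_assoc, h.mul_adjugate_self, one_mul]

theorem det_monodromy {u : ℝ → ℂ} (hu : Continuous u) (L : ℝ) (z : ℂ) :
    (monodromy u L z).det = 1 := by
  obtain ⟨Ψ, hΨ, -⟩ := existsUnique_isFundamental hu z
  rw [monodromy_eq hu L hΨ, hΨ.det_eq_one]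

theorem IsFundamental.continuous {u : ℝ → ℂ} {z : ℂ} {Ψ : ℝ → Matrix (Fin 2) (Fin 2) ℂ}
    (h : IsFundamental u z Ψ) : Continuous Ψ :=
  continuous_iff_continuousAt.2 fun x => (h.hasDerivAt x).continuousAt

/-- Floquet's theorem. -/
theorem IsFundamental.add_period {u : ℝ → ℂ} (hu : Continuous u) {L : ℝ}
    (hper : ∀ x, u (x + L) = u x) {z : ℂ} {Ψ : ℝ → Matrix (Fin 2) (Fin 2) ℂ}
    (h : IsFundamental u z Ψ) (x : ℝ) : Ψ (x + L) = Ψ x * monodromy u L z := by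
  have := h.eq_mul (Φ := fun x => Ψ (x + L)) (fun x => by
    have h1 := (h.hasDerivAt (x + L)).comp_add_const x L
    rwa [show zsMatrix u z (x + L) = zsMatrix u z x by simp [zsMatrix, hper]] at h1) x
  rw [this, monodromy_eq hu L h, zero_add]

/-- Moving the base point by τ conjugates the monodromy matrix by Ψ(τ). -/
theorem trace_monodromy_shift {u v : ℝ → ℂ} (hu : Continuous u) (hv : Continuous v) {L τ : ℝ}
    (hper : ∀ x, u (x + L) = u x) (huv : ∀ x, u (x + τ) = v x) (z : ℂ) :
    (monodromy v L z).trace = (monodromy u L z).trace := by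
  obtain ⟨Ψ, hΨ, -⟩ := existsUnique_isFundamental hu z
  obtain ⟨Φ, hΦ, -⟩ := existsUnique_isFundamental hv z
  have h1 : Ψ (L + τ) = Φ L * Ψ (0 + τ) := hΦ.eq_mul (Φ := fun x => Ψ (x + τ)) (fun x => by
    have h1 := (hΨ.hasDerivAt (x + τ)).comp_add_const x τ
    rwa [show zsMatrix u z (x + τ) = zsMatrix v z x by simp [zsMatrix, huv]] at h1) L
  rw [zero_add, add_comm, hΨ.add_period hu hper] at h1
  rw [monodromy_eq hv L hΦ]
  calc (Φ L).trace = (Φ L * Ψ τ * (Ψ τ).adjugate).trace := by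
        rw [mul_assoc, hΨ.mul_adjugate_self, mul_one]
    _ = ((Ψ τ).adjugate * Ψ τ * monodromy u L z).trace := by
        rw [← h1, Matrix.trace_mul_comm, mul_assoc]
    _ = _ := by rw [hΨ.adjugate_mul_self, one_mul]

/-- Conjugating the complex conjugate of Ψ by J = [[0, 1], [-1, 0]] gives the fundamental matrix at
z̄. -/
theorem trace_monodromy_conj {u : ℝ → ℂ} (hu : Continuous u) (L : ℝ) (z : ℂ) :
    (monodromy u L ((starRingEnd ℂ) z)).trace = (starRingEnd ℂ) (monodromy u L z).trace := by
  obtain ⟨Ψ, hΨ, -⟩ := existsUnique_isFundamental hu z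
  have hc : ∀ x i j, HasDerivAt (fun y => (starRingEnd ℂ) (Ψ y i j))
      ((starRingEnd ℂ) ((zsMatrix u z x * Ψ x) i j)) x := fun x i j =>
    (hΨ.deriv x i j).star
  have hΦ : IsFundamental u ((starRingEnd ℂ) z) fun x =>
      !![(starRingEnd ℂ) (Ψ x 1 1), -(starRingEnd ℂ) (Ψ x 1 0);
        -(starRingEnd ℂ) (Ψ x 0 1), (starRingEnd ℂ) (Ψ x 0 0)] := by
    refine ⟨?_, fun x i j => ?_⟩
    · rw [hΨ.init]
      ext i j
      fin_cases i <;> fin_cases j <;> simp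
    · have h00 := hc x 0 0
      have h01 := hc x 0 1
      have h10 := hc x 1 0
      have h11 := hc x 1 1
      fin_cases i <;> fin_cases j <;>
        simp [Matrix.mul_apply, zsMatrix] at h00 h01 h10 h11 ⊢
      · exact h11.congr_deriv (by ring)
      · exact h10.neg.congr_deriv (by ring)
      · exact h01.neg.congr_deriv (by ring)
      · exact h00.congr_deriv (by ring)
  rw [monodromy_eq hu L hΦ, monodromy_eq hu L hΨ]
  simp [Matrix.trace_fin_two, add_comm]

theorem isBlochEigenvalue_of_trace {u : ℝ → ℂ} (hu : Continuous u) {L : ℝ}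
    (hper : ∀ x, u (x + L) = u x) {z σ : ℂ} (hσ : σ ^ 2 = 1)
    (h : (monodromy u L z).trace = 2 * σ) : IsBlochEigenvalue u L σ z := by
  obtain ⟨Ψ, hΨ, -⟩ := existsUnique_isFundamental hu z
  -- det(T - σ) = 1 - σ tr T + σ² = 1 - σ² = 0. A kernel vector v then gives the Bloch solution Ψ v.
  have hdet : (monodromy u L z - σ • (1 : Matrix (Fin 2) (Fin 2) ℂ)).det = 0 := by
    have h1 := det_monodromy hu L z
    rw [Matrix.det_fin_two] at h1 ⊢
    rw [Matrix.trace_fin_two] at h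
    simp
    linear_combination h1 - σ * h - hσ
  obtain ⟨v, hv, hTv⟩ := Matrix.exists_mulVec_eq_zero_iff.2 hdet
  rw [Matrix.sub_mulVec, sub_eq_zero, Matrix.smul_mulVec, Matrix.one_mulVec] at hTv
  have hd : ∀ x i, HasDerivAt (fun y => (Ψ y).mulVec v i)
      ((zsMatrix u z x).mulVec ((Ψ x).mulVec v) i) x := fun x i => by
    rw [Matrix.mulVec_mulVec]
    simp only [Matrix.mulVec, dotProduct, Fin.sum_univ_two]
    exact ((hΨ.deriv x i 0).mul_const _).add ((hΨ.deriv x i 1).mul_const _)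
  refine ⟨fun x => (Ψ x).mulVec v, fun h0 => hv ?_, fun i x => (hd x i).differentiableAt,
    fun x => ?_, fun x => ?_⟩
  · have := congrFun h0 0
    simpa [hΨ.init] using this
  · ext i
    have d0 := (hd x 0).deriv
    have d1 := (hd x 1).deriv
    simp only [zsMatrix, Matrix.mulVec, dotProduct, Fin.sum_univ_two] at d0 d1
    fin_cases i <;> simp [zsOperator, Matrix.mulVec, dotProduct, d0, d1]
    · linear_combination (-z * (Ψ x 0 0 * v 0 + Ψ x 0 1 * v 1) +
        u x * (Ψ x 1 0 * v 0 + Ψ x 1 1 * v 1)) * I_sq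
    · linear_combination (-z * (Ψ x 1 0 * v 0 + Ψ x 1 1 * v 1) -
        (starRingEnd ℂ) (u x) * (Ψ x 0 0 * v 0 + Ψ x 0 1 * v 1)) * I_sq
  · change (Ψ (x + L)).mulVec v = _
    rw [hΨ.add_period hu hper, ← Matrix.mulVec_mulVec, hTv, Matrix.mulVec_smul]

/-! ### Analyticity of the trace of the monodromy matrix -/

theorem norm_trace_le (M : Matrix (Fin 2) (Fin 2) ℂ) : ‖M.trace‖ ≤ 2 * ‖M‖ := by
  rw [Matrix.trace_fin_two]
  have := norm_add_le (M 0 0) (M 1 1)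
  have := norm_entry_le M 0 0
  have := norm_entry_le M 1 1
  linarith

/-- Variation of constants: if Φ is fundamental at z + h, then adj(Ψ) Φ solves a system with
coefficient h · adj(Ψ) D Ψ. Its first-order expansion exhibits the derivative tr(Ψ(L) N(L)) with an
error O(h²). -/
theorem differentiable_trace_monodromy {u : ℝ → ℂ} (hu : Continuous u) {L : ℝ} (hL : 0 < L) :
    Differentiable ℂ fun z => (monodromy u L z).trace := by
  intro z
  obtain ⟨Ψ, hΨ, -⟩ := existsUnique_isFundamental hu z
  set D : Matrix (Fin 2) (Fin 2) ℂ := !![-I, 0; 0, I] with hD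
  have hVc : Continuous fun x => (Ψ x).adjugate * D * Ψ x :=
    ((hΨ.continuous.matrix_adjugate).mul continuous_const).mul hΨ.continuous
  obtain ⟨N, hN0, hN⟩ := exists_primitive hVc
  obtain ⟨K, hK⟩ := (isCompact_Icc (a := 0) (b := L)).exists_bound_of_continuousOn hVc.continuousOn
  have hK0 : 0 ≤ K := (norm_nonneg _).trans (hK 0 ⟨le_rfl, hL.le⟩)
  have key : ∀ h : ℂ, ‖h‖ ≤ 1 → ‖(monodromy u L (z + h)).trace - (monodromy u L z).trace -
      h • (Ψ L * N L).trace‖ ≤ 2 * (‖Ψ L‖ * (K * (K * (‖(1 : Matrix (Fin 2) (Fin 2) ℂ)‖ *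
        Real.exp (K * L)) * L) * L)) * ‖h ^ 2‖ := by
    intro h hh
    obtain ⟨Φ, hΦ, -⟩ := existsUnique_isFundamental hu (z + h)
    have hU : ∀ x, zsMatrix u (z + h) x = zsMatrix u z x + h • D := fun x => by
      ext i j
      fin_cases i <;> fin_cases j <;> simp [zsMatrix, hD] <;> ring
    have hY : ∀ x, HasDerivAt (fun x => (Ψ x).adjugate * Φ x)
        ((h • ((Ψ x).adjugate * D * Ψ x)) * ((Ψ x).adjugate * Φ x)) x := fun x => by
      refine ((hasDerivAt_adjugate (zsMatrix_traceless u z x) (hΨ.hasDerivAt x)).mul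
        (hΦ.hasDerivAt x)).congr_deriv ?_
      rw [hU, show (h • ((Ψ x).adjugate * D * Ψ x)) * ((Ψ x).adjugate * Φ x) =
        h • ((Ψ x).adjugate * D * (Ψ x * (Ψ x).adjugate) * Φ x) by
          simp only [smul_mul_assoc, mul_assoc], hΨ.mul_adjugate_self]
      simp only [add_mul, mul_add, mul_one, neg_mul, smul_mul_assoc, mul_smul_comm, mul_assoc]
      abel
    have bY := norm_sub_one_sub_le (L := L) (N := fun x => h • N x) (ρ := ‖h‖ * K) (by positivity)
      (by simp [hΨ.init, hΦ.init]) (fun x _ => hY x) (fun x hx => by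
        rw [norm_smul]
        exact mul_le_mul_of_nonneg_left (hK x hx) (norm_nonneg _)) (by simp [hN0])
      (fun x _ => (hN x).const_smul h) (x := L) ⟨hL.le, le_rfl⟩
    rw [monodromy_eq hu L hΦ, monodromy_eq hu L hΨ,
      show (Φ L).trace - (Ψ L).trace - h • (Ψ L * N L).trace =
        (Ψ L * ((Ψ L).adjugate * Φ L - 1 - h • N L)).trace by
        rw [mul_sub, mul_sub, ← mul_assoc, hΨ.mul_adjugate_self, one_mul, mul_one,
          mul_smul_comm, Matrix.trace_sub, Matrix.trace_sub, Matrix.trace_smul]]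
    refine (norm_trace_le _).trans ?_
    rw [mul_assoc 2]
    refine mul_le_mul_of_nonneg_left ((norm_mul_le _ _).trans ?_) (by norm_num)
    rw [mul_assoc ‖Ψ L‖]
    refine mul_le_mul_of_nonneg_left (bY.trans ?_) (norm_nonneg _)
    have hexp : Real.exp (‖h‖ * K * L) ≤ Real.exp (K * L) := by
      gcongr
      exact mul_le_of_le_one_left hK0 hh
    calc _ = K * (K * (‖(1 : Matrix (Fin 2) (Fin 2) ℂ)‖ * Real.exp (‖h‖ * K * L)) * L) * L *
          ‖h‖ ^ 2 := by ring
      _ ≤ _ := by rw [norm_pow]; gcongr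
  refine HasDerivAt.differentiableAt (f' := (Ψ L * N L).trace) ?_
  rw [hasDerivAt_iff_isLittleO_nhds_zero]
  have hO : (fun h => (monodromy u L (z + h)).trace - (monodromy u L z).trace -
      h • (Ψ L * N L).trace) =O[nhds 0] fun h : ℂ => h ^ 2 := by
    refine Asymptotics.IsBigO.of_bound (2 * (‖Ψ L‖ * (K * (K *
      (‖(1 : Matrix (Fin 2) (Fin 2) ℂ)‖ * Real.exp (K * L)) * L) * L))) ?_
    filter_upwards [Metric.closedBall_mem_nhds (0 : ℂ) one_pos] with h hh
    exact key h (mem_closedBall_zero_iff.1 hh)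
  exact hO.trans_isLittleO (Asymptotics.isLittleO_pow_id one_lt_two)

/-! ### The potential -/

theorem potential_add (L : ℝ) (n : ℕ) (cp cm : ℂ) {τ : ℝ} {η : ℂ} (hη : η ^ 2 = 1)
    (h : exp (I * (2 * Real.pi * n / L : ℝ) * τ) = η) (x : ℝ) :
    potential L n cp cm (x + τ) = potential L n (η * cp) (η * cm) x := by
  have h' : exp (-(I * (2 * Real.pi * n / L : ℝ) * τ)) = η := by
    rw [Complex.exp_neg, h]
    exact inv_eq_of_mul_eq_one_left (by rw [← sq, hη])
  simp only [potential]
  rw [ofReal_add, mul_add, neg_add, Complex.exp_add, Complex.exp_add, h, h']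
  ring

theorem potential_add_period {L : ℝ} (hL : 0 < L) (n : ℕ) (cp cm : ℂ) (x : ℝ) :
    potential L n cp cm (x + L) = potential L n cp cm x := by
  have hL' : (L : ℂ) ≠ 0 := by exact_mod_cast hL.ne'
  rw [potential_add L n cp cm (η := 1) (by norm_num)]
  · simp
  · rw [Complex.exp_eq_one_iff]
    refine ⟨n, ?_⟩
    push_cast
    field_simp

theorem potential_add_half {L : ℝ} (hL : 0 < L) {n : ℕ} (hn : 1 ≤ n) (cp cm : ℂ) (x : ℝ) :
    potential L n cp cm (x + L / (2 * n)) = potential L n (-cp) (-cm) x := by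
  have hL' : (L : ℂ) ≠ 0 := by exact_mod_cast hL.ne'
  have hn' : (n : ℂ) ≠ 0 := by exact_mod_cast (by omega : n ≠ 0)
  rw [potential_add L n cp cm (η := -1) (by norm_num)]
  · simp
  · rw [← Complex.exp_pi_mul_I]
    congr 1
    push_cast
    field_simp

/-- Half a wavelength of the harmonic is a translation that flips both coefficients. This evenness
is what justifies averaging over the sign of t. -/
theorem trace_monodromy_neg {L : ℝ} (hL : 0 < L) {n : ℕ} (hn : 1 ≤ n) (cp cm z : ℂ) :
    (monodromy (potential L n (-cp) (-cm)) L z).trace =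
      (monodromy (potential L n cp cm) L z).trace :=
  trace_monodromy_shift (continuous_potential _ _ _ _) (continuous_potential _ _ _ _)
    (potential_add_period hL n cp cm) (potential_add_half hL hn cp cm) z

end Monodromy

section Frame

attribute [local instance] Matrix.linftyOpNormedAddCommGroup Matrix.linftyOpNormedSpace
  Matrix.linftyOpNormedRing Matrix.linftyOpNormedAlgebra

/-! ### The linear problem in the eigenbasis of the constant background -/

theorem hasDerivAt_cexp_mul (c : ℂ) (x : ℝ) :
    HasDerivAt (fun y : ℝ => exp (c * y)) (c * exp (c * x)) x := by
  have h : HasDerivAt (fun y : ℝ => c * (y : ℂ)) (c * 1) x :=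
    (hasDerivAt_id x).ofReal_comp.const_mul c
  exact h.cexp.congr_deriv (by ring)

theorem exp_mul_exp_neg (c : ℂ) (x : ℝ) : exp (c * x) * exp (-c * x) = 1 := by
  rw [← Complex.exp_add, neg_mul, add_neg_cancel, Complex.exp_zero]

/-- Eigenvectors of the linear problem on the constant background. -/
noncomputable def frame (m : ℝ) (w : ℂ) (x : ℝ) : Matrix (Fin 2) (Fin 2) ℂ :=
  !![exp (I * m * x), exp (-(I * m) * x);
    (m + w) * exp (I * m * x), (w - m) * exp (-(I * m) * x)]

/-- The derivative of the linear problem in the spectral parameter, in the frame. -/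
noncomputable def frameSpectral (m : ℝ) (w : ℂ) (x : ℝ) : Matrix (Fin 2) (Fin 2) ℂ :=
  !![I * w / m, I * (w - m) / m * exp (-(I * m) * x) ^ 2;
    -(I * (m + w) / m) * exp (I * m * x) ^ 2, -(I * w / m)]

/-- The perturbation of the potential, in the frame. -/
noncomputable def framePotential (m : ℝ) (w a b : ℂ) (x : ℝ) : Matrix (Fin 2) (Fin 2) ℂ :=
  (I / (2 * m)) • !![(a + (starRingEnd ℂ) b) * exp (I * m * x) ^ 2 +
      (b + (starRingEnd ℂ) a) * exp (-(I * m) * x) ^ 2,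
    ((starRingEnd ℂ) b - (m - w) ^ 2 * a) +
      ((starRingEnd ℂ) a - (m - w) ^ 2 * b) * exp (-(I * m) * x) ^ 4;
    -((starRingEnd ℂ) a - (m + w) ^ 2 * b) -
      ((starRingEnd ℂ) b - (m + w) ^ 2 * a) * exp (I * m * x) ^ 4,
    -((a + (starRingEnd ℂ) b) * exp (I * m * x) ^ 2 +
      (b + (starRingEnd ℂ) a) * exp (-(I * m) * x) ^ 2)]

/-- At x = L with m = μ_n the exponentials return to 1, so only the terms linear in x survive: here
the diagonal. -/
noncomputable def frameSpectralPrimitive (m : ℝ) (w : ℂ) (x : ℝ) : Matrix (Fin 2) (Fin 2) ℂ :=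
  !![I * w / m * x, -((w - m) / (2 * m ^ 2)) * (exp (-(I * m) * x) ^ 2 - 1);
    -((m + w) / (2 * m ^ 2)) * (exp (I * m * x) ^ 2 - 1), -(I * w / m) * x]

/-- At x = L with m = μ_n only the resonant off-diagonal terms survive. For w = λ_n they are
multiples of β and -α; this is where these combinations come from. -/
noncomputable def framePotentialPrimitive (m : ℝ) (w a b : ℂ) (x : ℝ) :
    Matrix (Fin 2) (Fin 2) ℂ :=
  (I / (2 * m)) • !![(a + (starRingEnd ℂ) b) * ((exp (I * m * x) ^ 2 - 1) / (2 * I * m)) -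
      (b + (starRingEnd ℂ) a) * ((exp (-(I * m) * x) ^ 2 - 1) / (2 * I * m)),
    ((starRingEnd ℂ) b - (m - w) ^ 2 * a) * x -
      ((starRingEnd ℂ) a - (m - w) ^ 2 * b) * ((exp (-(I * m) * x) ^ 4 - 1) / (4 * I * m));
    -((starRingEnd ℂ) a - (m + w) ^ 2 * b) * x -
      ((starRingEnd ℂ) b - (m + w) ^ 2 * a) * ((exp (I * m * x) ^ 4 - 1) / (4 * I * m)),
    -((a + (starRingEnd ℂ) b) * ((exp (I * m * x) ^ 2 - 1) / (2 * I * m)) -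
      (b + (starRingEnd ℂ) a) * ((exp (-(I * m) * x) ^ 2 - 1) / (2 * I * m)))]

variable {m : ℝ} {w : ℂ}

theorem frameSpectralPrimitive_zero : frameSpectralPrimitive m w 0 = 0 := by
  ext i j
  fin_cases i <;> fin_cases j <;> simp [frameSpectralPrimitive]

theorem framePotentialPrimitive_zero (a b : ℂ) : framePotentialPrimitive m w a b 0 = 0 := by
  ext i j
  fin_cases i <;> fin_cases j <;> simp [framePotentialPrimitive]

theorem hasDerivAt_frameSpectralPrimitive (hm : m ≠ 0) (x : ℝ) :
    HasDerivAt (frameSpectralPrimitive m w) (frameSpectral m w x) x := by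
  have hm' : (m : ℂ) ≠ 0 := by exact_mod_cast hm
  have hp := hasDerivAt_cexp_mul (I * m) x
  have hn := hasDerivAt_cexp_mul (-(I * m)) x
  have hx : HasDerivAt (fun y : ℝ => (y : ℂ)) 1 x := (hasDerivAt_id x).ofReal_comp
  refine hasDerivAt_matrix.2 fun i j => ?_
  fin_cases i <;> fin_cases j <;> simp only [frameSpectralPrimitive, frameSpectral,
    Fin.zero_eta, Fin.mk_one, Matrix.of_apply, Matrix.cons_val', Matrix.cons_val_zero,
    Matrix.cons_val_one, Matrix.cons_val_fin_one, Fin.isValue]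
  · exact (hx.const_mul _).congr_deriv (by ring)
  · exact (((hn.pow 2).sub_const 1).const_mul _).congr_deriv (by push_cast; field_simp)
  · exact (((hp.pow 2).sub_const 1).const_mul _).congr_deriv (by push_cast; field_simp)
  · exact (hx.const_mul _).congr_deriv (by ring)

theorem hasDerivAt_framePotentialPrimitive (hm : m ≠ 0) (a b : ℂ) (x : ℝ) :
    HasDerivAt (framePotentialPrimitive m w a b) (framePotential m w a b x) x := by
  have hm' : (m : ℂ) ≠ 0 := by exact_mod_cast hm
  have hp := hasDerivAt_cexp_mul (I * m) x
  have hn := hasDerivAt_cexp_mul (-(I * m)) x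
  have hx : HasDerivAt (fun y : ℝ => (y : ℂ)) 1 x := (hasDerivAt_id x).ofReal_comp
  have hp2 := ((hp.pow 2).sub_const 1).div_const (2 * I * m)
  have hn2 := ((hn.pow 2).sub_const 1).div_const (2 * I * m)
  have hp4 := ((hp.pow 4).sub_const 1).div_const (4 * I * m)
  have hn4 := ((hn.pow 4).sub_const 1).div_const (4 * I * m)
  have hd := (hp2.const_mul (a + (starRingEnd ℂ) b)).sub (hn2.const_mul (b + (starRingEnd ℂ) a))
  refine HasDerivAt.const_smul (I / (2 * (m : ℂ))) (hasDerivAt_matrix.2 fun i j => ?_)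
  fin_cases i <;> fin_cases j <;> simp only [
    Fin.zero_eta, Fin.mk_one, Matrix.of_apply, Matrix.cons_val', Matrix.cons_val_zero,
    Matrix.cons_val_one, Matrix.cons_val_fin_one, Fin.isValue]
  · exact hd.congr_deriv (by push_cast; field_simp [I_ne_zero]; ring)
  · exact ((hx.const_mul _).sub (hn4.const_mul _)).congr_deriv
      (by push_cast; field_simp [I_ne_zero]; ring)
  · exact ((hx.const_mul _).sub (hp4.const_mul _)).congr_deriv
      (by push_cast; field_simp [I_ne_zero])
  · exact hd.neg.congr_deriv (by push_cast; field_simp [I_ne_zero]; ring)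

theorem continuous_frameSpectral : Continuous (frameSpectral m w) := by
  refine continuous_matrix fun i j => ?_
  fin_cases i <;> fin_cases j <;> simp [frameSpectral] <;> fun_prop

theorem continuous_framePotential (a b : ℂ) : Continuous (framePotential m w a b) := by
  refine continuous_matrix fun i j => ?_
  fin_cases i <;> fin_cases j <;> simp [framePotential] <;> fun_prop

theorem norm_exp_I_mul (m x : ℝ) : ‖exp (I * m * x)‖ = 1 := by
  rw [show I * (m : ℂ) * x = ((m * x : ℝ) : ℂ) * I by push_cast; ring]
  exact norm_exp_ofReal_mul_I _

theorem norm_exp_neg_I_mul (m x : ℝ) : ‖exp (-(I * m) * x)‖ = 1 := by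
  simpa using norm_exp_I_mul (-m) x

theorem norm_frameSpectral_le (m : ℝ) (w : ℂ) (x : ℝ) :
    ‖frameSpectral m w x‖ ≤ 2 * ((|m| + ‖w‖) / |m|) := by
  have h1 := norm_sub_le w m
  have h2 := norm_add_le (m : ℂ) w
  rw [norm_real, Real.norm_eq_abs] at h1 h2
  refine norm_le_of_entry_le (by positivity) fun i j => ?_
  fin_cases i <;> fin_cases j <;>
    simp [frameSpectral, norm_exp_I_mul, norm_exp_neg_I_mul, -neg_mul] <;> gcongr <;>
    linarith [abs_nonneg m]

theorem norm_framePotential_le (m : ℝ) (w : ℂ) {a b : ℂ} (ha : ‖a‖ ≤ 1) (hb : ‖b‖ ≤ 1) (x : ℝ) :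
    ‖framePotential m w a b x‖ ≤ 2 * (1 / (2 * |m|) * (4 + 2 * (|m| + ‖w‖) ^ 2)) := by
  have h1 : ‖(m : ℂ) - w‖ ≤ |m| + ‖w‖ := by simpa using norm_sub_le (m : ℂ) w
  have h2 : ‖(m : ℂ) + w‖ ≤ |m| + ‖w‖ := by simpa using norm_add_le (m : ℂ) w
  have hp := norm_exp_I_mul m x
  have hn := norm_exp_neg_I_mul m x
  have hab : ∀ c d s : ℂ, ‖c‖ ≤ 1 → ‖d‖ ≤ 1 → ‖s‖ ≤ |m| + ‖w‖ →
      ‖(starRingEnd ℂ) c - s ^ 2 * d‖ ≤ 1 + (|m| + ‖w‖) ^ 2 := fun c d s hc hd hs => by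
    refine (norm_sub_le _ _).trans (add_le_add (by simpa using hc) ?_)
    rw [norm_mul, norm_pow]
    calc ‖s‖ ^ 2 * ‖d‖ ≤ (|m| + ‖w‖) ^ 2 * 1 := by gcongr
      _ = _ := mul_one _
  have hdiag : ‖(a + (starRingEnd ℂ) b) * exp (I * m * x) ^ 2 +
      (b + (starRingEnd ℂ) a) * exp (-(I * m) * x) ^ 2‖ ≤ 4 + 2 * (|m| + ‖w‖) ^ 2 := by
    refine (norm_add_le _ _).trans ?_
    rw [norm_mul, norm_mul, norm_pow, norm_pow, hp, hn]
    have e1 := norm_add_le a ((starRingEnd ℂ) b)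
    have e2 := norm_add_le b ((starRingEnd ℂ) a)
    rw [RCLike.norm_conj] at e1 e2
    nlinarith [sq_nonneg (|m| + ‖w‖)]
  have hoff : ∀ c d s e : ℂ, ‖c‖ ≤ 1 → ‖d‖ ≤ 1 → ‖s‖ ≤ |m| + ‖w‖ → ‖e‖ = 1 →
      ‖((starRingEnd ℂ) c - s ^ 2 * d) + ((starRingEnd ℂ) d - s ^ 2 * c) * e ^ 4‖ ≤
        4 + 2 * (|m| + ‖w‖) ^ 2 := fun c d s e hc hd hs he => by
    refine (norm_add_le _ _).trans ?_
    rw [norm_mul, norm_pow, he]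
    linarith [hab c d s hc hd hs, hab d c s hd hc hs]
  unfold framePotential
  rw [norm_smul]
  have hI : ‖I / (2 * (m : ℂ))‖ = 1 / (2 * |m|) := by simp
  rw [hI, mul_left_comm]
  refine mul_le_mul_of_nonneg_left (norm_le_of_entry_le (by positivity) fun i j => ?_)
    (by positivity)
  fin_cases i <;> fin_cases j <;> simp only [
    Fin.zero_eta, Fin.mk_one, Matrix.of_apply, Matrix.cons_val', Matrix.cons_val_zero,
    Matrix.cons_val_one, Matrix.cons_val_fin_one, Fin.isValue]
  · exact hdiag
  · exact hoff b a _ _ hb ha h1 hn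
  · rw [← norm_neg, neg_sub, sub_neg_eq_add, add_comm]
    exact hoff a b _ _ ha hb h2 hp
  · rwa [norm_neg]

/-- The relation w² = m² - 1 says that ±im are the eigenvalues of the constant coefficient matrix,
with eigenvectors (1, w ± m). -/
theorem hasDerivAt_frame (hw : w ^ 2 = m ^ 2 - 1) (x : ℝ) :
    HasDerivAt (frame m w) (!![-(I * w), I; I, I * w] * frame m w x) x := by
  have hp := hasDerivAt_cexp_mul (I * m) x
  have hn := hasDerivAt_cexp_mul (-(I * m)) x
  refine hasDerivAt_matrix.2 fun i j => ?_
  fin_cases i <;> fin_cases j <;> simp only [frame, Matrix.mul_apply, Fin.sum_univ_two,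
    Fin.zero_eta, Fin.mk_one, Matrix.of_apply, Matrix.cons_val', Matrix.cons_val_zero,
    Matrix.cons_val_one, Matrix.cons_val_fin_one, Fin.isValue]
  · exact hp.congr_deriv (by ring)
  · exact hn.congr_deriv (by ring)
  · exact (hp.const_mul _).congr_deriv (by linear_combination (-(I * exp (I * m * x))) * hw)
  · exact (hn.const_mul _).congr_deriv (by linear_combination (-(I * exp (-(I * m) * x))) * hw)

/-- An inverse-free form of V = Q⁻¹ D Q, where Q is the frame. The next lemma is the same
conjugation for the perturbation of the potential. -/
theorem frameSpectral_mul_adjugate (hm : m ≠ 0) (x : ℝ) :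
    frameSpectral m w x * (frame m w x).adjugate = (frame m w x).adjugate * !![-I, 0; 0, I] := by
  have hm' : (m : ℂ) ≠ 0 := by exact_mod_cast hm
  have h := exp_mul_exp_neg (I * m) x
  generalize he : exp (I * m * x) = e at h
  generalize hf : exp (-(I * m) * x) = f at h
  ext i j
  fin_cases i <;> fin_cases j <;> simp only [frame, frameSpectral, he, hf, Matrix.mul_apply,
    Matrix.adjugate_fin_two, Fin.sum_univ_two,
    Fin.zero_eta, Fin.mk_one, Matrix.of_apply, Matrix.cons_val', Matrix.cons_val_zero,
    Matrix.cons_val_one, Matrix.cons_val_fin_one, Fin.isValue] <;> field_simp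
  · linear_combination I * (-(w - m) * (m + w) * f) * h
  · linear_combination I * ((w - m) * f) * h
  · linear_combination I * (-(w - m) * (m + w) * e) * h
  · linear_combination I * ((m + w) * e) * h

theorem framePotential_mul_adjugate (hm : m ≠ 0) (hw : w ^ 2 = m ^ 2 - 1) (a b : ℂ) (x : ℝ) :
    framePotential m w a b x * (frame m w x).adjugate = (frame m w x).adjugate *
      !![0, I * (a * exp (I * m * x) ^ 2 + b * exp (-(I * m) * x) ^ 2);
        I * ((starRingEnd ℂ) a * exp (-(I * m) * x) ^ 2 +
          (starRingEnd ℂ) b * exp (I * m * x) ^ 2), 0] := by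
  have hm' : (m : ℂ) ≠ 0 := by exact_mod_cast hm
  have h := exp_mul_exp_neg (I * m) x
  generalize he : exp (I * m * x) = e at h
  generalize hf : exp (-(I * m) * x) = f at h
  generalize ha' : (starRingEnd ℂ) a = a'
  generalize hb' : (starRingEnd ℂ) b = b'
  ext i j
  fin_cases i <;> fin_cases j <;> simp only [frame, framePotential, he, hf, Matrix.mul_apply,
    Matrix.adjugate_fin_two, Fin.sum_univ_two, Matrix.smul_apply, smul_eq_mul,
    Fin.zero_eta, Fin.mk_one, Matrix.of_apply, Matrix.cons_val', Matrix.cons_val_zero,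
    Matrix.cons_val_one, Matrix.cons_val_fin_one, Fin.isValue, ha', hb'] <;> field_simp
  · grind
  · grind
  · grind
  · grind

theorem adjugate_frame_mul (m : ℝ) (w : ℂ) (x : ℝ) :
    (frame m w x).adjugate * frame m w x = (-(2 * m) : ℂ) • 1 := by
  rw [Matrix.adjugate_mul]
  congr 1
  rw [Matrix.det_fin_two]
  simp only [frame, Matrix.of_apply, Matrix.cons_val', Matrix.cons_val_zero,
    Matrix.cons_val_one, Matrix.cons_val_fin_one]
  linear_combination (-2 * m) * exp_mul_exp_neg (I * m) x

theorem det_frame (m : ℝ) (w : ℂ) (x : ℝ) : (frame m w x).det = -(2 * m) := by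
  have := adjugate_frame_mul m w x
  rw [Matrix.adjugate_mul] at this
  simpa using congrFun (congrFun this 0) 0

/-! ### Behaviour over one period and expansion of the trace. -/

theorem mu_ne_zero {L : ℝ} (hL : 0 < L) {n : ℕ} (hn : 1 ≤ n) : mu L n ≠ 0 := by
  have : 0 < n := hn
  unfold mu
  positivity

theorem exp_mu_period {L : ℝ} (hL : 0 < L) (n : ℕ) : exp (I * mu L n * L) = (-1) ^ n := by
  have hL' : (L : ℂ) ≠ 0 := by exact_mod_cast hL.ne'
  rw [← Complex.exp_pi_mul_I, ← Complex.exp_nat_mul]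
  congr 1
  unfold mu
  push_cast
  field_simp

theorem exp_neg_mu_period {L : ℝ} (hL : 0 < L) (n : ℕ) :
    exp (-(I * mu L n) * L) = (-1) ^ n := by
  have h := exp_mul_exp_neg (I * mu L n) L
  rw [exp_mu_period hL] at h
  have h2 : ((-1 : ℂ) ^ n) * (-1) ^ n = 1 := by rw [← mul_pow]; simp
  have h3 : ((-1 : ℂ) ^ n) ≠ 0 := by simp
  exact mul_left_cancel₀ h3 (h.trans h2.symm)

theorem potential_eq (L : ℝ) (n : ℕ) (a b : ℂ) (x : ℝ) :
    potential L n a b x =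
      1 + (a * exp (I * mu L n * x) ^ 2 + b * exp (-(I * mu L n) * x) ^ 2) := by
  unfold potential
  rw [← Complex.exp_nat_mul, ← Complex.exp_nat_mul]
  congr 4 <;> · unfold mu; push_cast; ring_nf

theorem conj_potential_eq (L : ℝ) (n : ℕ) (a b : ℂ) (x : ℝ) :
    (starRingEnd ℂ) (potential L n a b x) = 1 + ((starRingEnd ℂ) a * exp (-(I * mu L n) * x) ^ 2 +
      (starRingEnd ℂ) b * exp (I * mu L n * x) ^ 2) := by
  rw [potential_eq]
  simp [← Complex.exp_conj]

/-- The linear problem in the frame, and the trace of the monodromy matrix. -/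
theorem exists_frame_solution {L : ℝ} (hL : 0 < L) {n : ℕ} (hn : 1 ≤ n)
    (hw : w ^ 2 = mu L n ^ 2 - 1) (a b ζ : ℂ) (t : ℝ) :
    ∃ Y : ℝ → Matrix (Fin 2) (Fin 2) ℂ, Y 0 = 1 ∧
      (∀ x, HasDerivAt Y ((ζ • frameSpectral (mu L n) w x +
        (t : ℂ) • framePotential (mu L n) w a b x) * Y x) x) ∧
      (Y L - 1).det =
        2 - (-1) ^ n * (monodromy (potential L n (t * a) (t * b)) L (w + ζ)).trace ∧
      (Y L = 1 → monodromy (potential L n (t * a) (t * b)) L (w + ζ) = (-1 : ℂ) ^ n • 1) := by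
  set m := mu L n with hmdef
  have hm : m ≠ 0 := mu_ne_zero hL hn
  have hm' : (m : ℂ) ≠ 0 := by exact_mod_cast hm
  have hu := continuous_potential L n (t * a) (t * b)
  obtain ⟨Ψ, hΨ, -⟩ := existsUnique_isFundamental hu (w + ζ)
  set c : ℂ := (-(2 * m))⁻¹ with hc
  have hcm : c * -(2 * m) = 1 := inv_mul_cancel₀ (by simpa using hm')
  set Q := frame m w with hQ
  set D : Matrix (Fin 2) (Fin 2) ℂ := !![-I, 0; 0, I] with hD
  set B : ℝ → Matrix (Fin 2) (Fin 2) ℂ := fun x =>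
    !![0, I * (a * exp (I * m * x) ^ 2 + b * exp (-(I * m) * x) ^ 2);
        I * ((starRingEnd ℂ) a * exp (-(I * m) * x) ^ 2 +
          (starRingEnd ℂ) b * exp (I * m * x) ^ 2), 0] with hB
  have hU : ∀ x, zsMatrix (potential L n (t * a) (t * b)) (w + ζ) x =
      !![-(I * w), I; I, I * w] + (ζ • D + (t : ℂ) • B x) := fun x => by
    rw [zsMatrix, conj_potential_eq, potential_eq, ← hmdef]
    ext i j
    fin_cases i <;> fin_cases j <;> simp [hD, hB, -neg_mul] <;> ring
  have hσ : ((-1 : ℂ) ^ n) * (-1) ^ n = 1 := by rw [← mul_pow]; simp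
  -- Both e^{±iμL} equal (-1)^n. Hence Y(L) is (-1)^n times a conjugate of the monodromy matrix.
  have hQL : Q L = (-1 : ℂ) ^ n • Q 0 := by
    ext i j
    fin_cases i <;> fin_cases j <;>
      simp [hQ, frame, exp_mu_period hL, exp_neg_mu_period hL, hmdef, -neg_mul] <;> ring
  have hQQ : Q 0 * (Q 0).adjugate = (-(2 * m) : ℂ) • 1 := by
    rw [Matrix.mul_adjugate, hQ, det_frame]
  have hYL : (Q L).adjugate = (-1 : ℂ) ^ n • (Q 0).adjugate := by
    rw [hQL, Matrix.adjugate_smul]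
    simp
  -- Since det Q = -2m and c is its inverse, this is Q(x)⁻¹ Ψ(x) Q(0).
  set Y : ℝ → Matrix (Fin 2) (Fin 2) ℂ := fun x => c • ((Q x).adjugate * Ψ x * Q 0) with hY
  have htr : (Y L).trace = (-1) ^ n * (Ψ L).trace := by
    simp only [hY, hYL]
    rw [mul_assoc, Matrix.trace_smul, smul_mul_assoc, Matrix.trace_smul, Matrix.trace_mul_comm,
      mul_assoc, hQQ, mul_smul_comm, mul_one, Matrix.trace_smul, smul_eq_mul, smul_eq_mul,
      smul_eq_mul]
    linear_combination ((-1) ^ n * (Ψ L).trace) * hcm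
  have hdet : (Y L).det = 1 := by
    simp only [hY, hYL]
    rw [Matrix.det_smul, Matrix.det_mul, Matrix.det_mul, hΨ.det_eq_one, Matrix.det_smul,
      Matrix.det_adjugate, hQ, det_frame]
    simp only [Fintype.card_fin, Nat.add_one_sub_one, pow_one, mul_one]
    linear_combination ((-1 : ℂ) ^ n) ^ 2 * (c * -(2 * m) + 1) * hcm + hσ
  refine ⟨Y, ?_, fun x => ?_, ?_, fun h1 => ?_⟩
  · simp only [hY, hΨ.init, mul_one, hQ, adjugate_frame_mul, smul_smul]
    rw [hcm, one_smul]
  · have hV : (ζ • frameSpectral m w x + (t : ℂ) • framePotential m w a b x) * (Q x).adjugate =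
        (Q x).adjugate * (ζ • D + (t : ℂ) • B x) := by
      rw [add_mul, smul_mul_assoc, smul_mul_assoc, frameSpectral_mul_adjugate hm,
        framePotential_mul_adjugate hm hw, ← mul_smul_comm, ← mul_smul_comm, ← mul_add]
    have h1 := (((hasDerivAt_adjugate (by simp) (hasDerivAt_frame hw x)).mul
      (hΨ.hasDerivAt x)).mul_const (Q 0)).const_smul c
    refine h1.congr_deriv ?_
    have h2 : (ζ • frameSpectral m w x + (t : ℂ) • framePotential m w a b x) *
        ((Q x).adjugate * Ψ x * Q 0) = (Q x).adjugate * (ζ • D + (t : ℂ) • B x) * Ψ x * Q 0 := by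
      rw [← mul_assoc, ← mul_assoc, hV]
    simp only [hY]
    rw [mul_smul_comm, h2, hU]
    congr 1
    noncomm_ring
  · rw [monodromy_eq hu L hΨ, ← htr]
    rw [Matrix.det_fin_two] at hdet ⊢
    rw [Matrix.trace_fin_two]
    simp only [Matrix.sub_apply, Matrix.one_apply_eq, Matrix.one_apply_ne (zero_ne_one' (Fin 2)),
      Matrix.one_apply_ne (one_ne_zero' (Fin 2)), sub_zero]
    linear_combination hdet
  · rw [monodromy_eq hu L hΨ]
    have h2 : Q 0 * Y L * (Q 0).adjugate = Q 0 * (Q 0).adjugate := by rw [h1, mul_one]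
    simp only [hY, hYL, hQQ] at h2
    have h3 : Q 0 * c • ((-1 : ℂ) ^ n • (Q 0).adjugate * Ψ L * Q 0) * (Q 0).adjugate =
        (c * (-1) ^ n) • ((Q 0 * (Q 0).adjugate) * Ψ L * (Q 0 * (Q 0).adjugate)) := by
      simp only [mul_smul_comm, smul_mul_assoc, smul_smul, mul_assoc]
    rw [h3, hQQ] at h2
    simp only [mul_smul_comm, smul_mul_assoc, smul_smul, one_mul, mul_one] at h2
    have h4 := congrArg (fun M => (c * (-1 : ℂ) ^ n) • M) h2
    simp only [smul_smul] at h4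
    rw [show c * (-1) ^ n * (c * (-1) ^ n * (-(2 * (m : ℂ)) * -(2 * m))) = 1 by
        linear_combination ((-1 : ℂ) ^ n) ^ 2 * (c * -(2 * m) + 1) * hcm + hσ,
      show c * (-1) ^ n * -(2 * (m : ℂ)) = (-1) ^ n by linear_combination (-1) ^ n * hcm,
      one_smul] at h4
    exact h4

/-- Expansion of the trace of the monodromy matrix near a double point. -/
theorem exists_trace_expansion {L : ℝ} (hL : 0 < L) {n : ℕ} (hn : 1 ≤ n)
    (hw : w ^ 2 = mu L n ^ 2 - 1) (hw0 : w ≠ 0) : ∃ K : ℝ, 1 ≤ K ∧ ∀ a b : ℂ, ‖a‖ ≤ 1 → ‖b‖ ≤ 1 →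
    ∀ (ζ : ℂ) (t : ℝ), ‖ζ‖ ≤ 1 → 0 ≤ t → t ≤ 1 →
    ‖mu L n ^ 2 / (L ^ 2 * w ^ 2) *
        (2 - (-1) ^ n * (monodromy (potential L n (t * a) (t * b)) L (w + ζ)).trace) -
      (ζ ^ 2 - t ^ 2 * (((starRingEnd ℂ) a - (mu L n + w) ^ 2 * b) *
        ((starRingEnd ℂ) b - (mu L n - w) ^ 2 * a)) / (4 * w ^ 2))‖ ≤
      K * (‖ζ‖ ^ 3 + t ^ 2 * ‖ζ‖ + t ^ 4) := by
  have hm : mu L n ≠ 0 := mu_ne_zero hL hn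
  have hm' : (mu L n : ℂ) ≠ 0 := by exact_mod_cast hm
  have hL' : (L : ℂ) ≠ 0 := by exact_mod_cast hL.ne'
  set K₀ : ℝ := max (2 * ((|mu L n| + ‖w‖) / |mu L n|))
    (2 * (1 / (2 * |mu L n|) * (4 + 2 * (|mu L n| + ‖w‖) ^ 2))) with hK₀
  have hK₀0 : 0 ≤ K₀ := le_max_of_le_left (by positivity)
  obtain ⟨C, hC0, hC⟩ := exists_det_expansion hL K₀ hK₀0
  -- A = 1 / det N₁(L), which normalizes the coefficient of ζ² to 1.
  set A : ℂ := mu L n ^ 2 / (L ^ 2 * w ^ 2) with hA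
  refine ⟨max 1 (‖A‖ * C / 2), le_max_left _ _, fun a b ha hb ζ t hζ ht0 ht1 => ?_⟩
  obtain ⟨Y, hY0, hY, hYd, -⟩ := exists_frame_solution hL hn hw a b ζ t
  obtain ⟨Y', hY'0, hY', hY'd, -⟩ := exists_frame_solution hL hn hw a b ζ (-t)
  have hneg : (monodromy (potential L n (↑(-t) * a) (↑(-t) * b)) L (w + ζ)).trace =
      (monodromy (potential L n (t * a) (t * b)) L (w + ζ)).trace := by
    rw [ofReal_neg, neg_mul, neg_mul]
    exact trace_monodromy_neg hL hn _ _ _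
  rw [hneg, ← hYd] at hY'd
  have key := hC _ _ _ _ continuous_frameSpectral (continuous_framePotential a b)
    (fun x => (norm_frameSpectral_le _ w x).trans (le_max_left _ _))
    (fun x => (norm_framePotential_le _ w ha hb x).trans (le_max_right _ _))
    frameSpectralPrimitive_zero (framePotentialPrimitive_zero a b)
    (hasDerivAt_frameSpectralPrimitive hm) (hasDerivAt_framePotentialPrimitive hm a b)
    ζ t hζ ht0 ht1 Y Y' hY0 hY'0 hY (by simpa using hY')
  rw [hY'd] at key
  have hσ : ((-1 : ℂ) ^ n) ^ 2 = 1 := by rw [← pow_mul, mul_comm, pow_mul]; simp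
  have hσ4 : ((-1 : ℂ) ^ n) ^ 4 = 1 := by rw [← pow_mul, mul_comm, pow_mul]; norm_num
  have hd₁ : (frameSpectralPrimitive (mu L n) w L).det = L ^ 2 * w ^ 2 / mu L n ^ 2 := by
    rw [Matrix.det_fin_two]
    simp only [frameSpectralPrimitive, exp_mu_period hL, exp_neg_mu_period hL, hσ,
      Matrix.of_apply, Matrix.cons_val', Matrix.cons_val_zero,
      Matrix.cons_val_one, Matrix.cons_val_fin_one, sub_self, mul_zero, sub_zero]
    linear_combination (-(L ^ 2 * w ^ 2 / mu L n ^ 2) : ℂ) * I_sq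
  have hd₂ : (framePotentialPrimitive (mu L n) w a b L).det =
      -(L ^ 2 / (4 * mu L n ^ 2)) * (((starRingEnd ℂ) a - (mu L n + w) ^ 2 * b) *
        ((starRingEnd ℂ) b - (mu L n - w) ^ 2 * a)) := by
    rw [framePotentialPrimitive, Matrix.det_smul, Matrix.det_fin_two]
    simp only [exp_mu_period hL, exp_neg_mu_period hL, hσ, hσ4,
      Matrix.of_apply, Matrix.cons_val', Matrix.cons_val_zero,
      Matrix.cons_val_one, Matrix.cons_val_fin_one, sub_self, zero_div, mul_zero, sub_zero,
      Fintype.card_fin, div_pow, I_sq, mul_pow]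
    field_simp
    ring
  rw [hd₁, hd₂] at key
  set X : ℂ := (((starRingEnd ℂ) a - (mu L n + w) ^ 2 * b) *
        ((starRingEnd ℂ) b - (mu L n - w) ^ 2 * a)) with hX
  rw [← hYd]
  have e : A * (Y L - 1).det - (ζ ^ 2 - t ^ 2 * X / (4 * w ^ 2)) =
      A / 2 * ((Y L - 1).det + (Y L - 1).det - 2 * (ζ ^ 2 * (L ^ 2 * w ^ 2 / mu L n ^ 2) +
        t ^ 2 * (-(L ^ 2 / (4 * mu L n ^ 2)) * X))) := by
    rw [hA]
    field_simp
    ring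
  rw [e, norm_mul, norm_div, Complex.norm_two]
  refine (mul_le_mul_of_nonneg_left key (by positivity)).trans ?_
  rw [← mul_assoc]
  refine mul_le_mul_of_nonneg_right (le_max_of_le_right (le_of_eq (by ring))) (by positivity)

/-- The monodromy matrix of the constant background at a double point. -/
theorem monodromy_background {L : ℝ} (hL : 0 < L) {n : ℕ} (hn : 1 ≤ n)
    (hw : w ^ 2 = mu L n ^ 2 - 1) : monodromy (potential L n 0 0) L w = (-1 : ℂ) ^ n • 1 := by
  obtain ⟨Y, hY0, hY, -, h⟩ := exists_frame_solution hL hn hw 0 0 0 0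
  simp only [zero_smul, ofReal_zero, add_zero, zero_mul] at h hY
  refine h ?_
  rw [← hY0]
  exact is_const_of_deriv_eq_zero (fun x => (hY x).differentiableAt) (fun x => (hY x).deriv) L 0

end Frame

/-! ### Spectral pairs -/

theorem analyticOrderAt_sub_const (c z : ℂ) :
    analyticOrderAt (fun y => y - c) z = if c = z then 1 else 0 := by
  split_ifs with h
  · subst h
    rw [show (1 : ℕ∞) = ((1 : ℕ) : ℕ∞) by simp,
      AnalyticAt.analyticOrderAt_eq_natCast (by fun_prop)]
    exact ⟨fun _ => 1, analyticAt_const, one_ne_zero, by simp⟩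
  · rw [analyticOrderAt_eq_zero]
    exact Or.inr (sub_ne_zero.2 (Ne.symm h))

/-- The discriminant is the product of `(z - E 0) * (z - E 1)` and of an entire function without
zeros in the disc of centre `a` and radius `r`. -/
def HasQuadraticFactor (u : ℝ → ℂ) (L : ℝ) (a : ℂ) (r : ℝ) (E : Fin 2 → ℂ) : Prop :=
  (∀ l, E l ∈ Metric.ball a r) ∧ ∃ Q : ℂ → ℂ, Differentiable ℂ Q ∧
    (∀ z, curveDiscr u L z = (z - E 0) * (z - E 1) * Q z) ∧ ∀ z ∈ Metric.ball a r, Q z ≠ 0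

theorem HasQuadraticFactor.isSpectralPair {u : ℝ → ℂ} {L : ℝ} {a : ℂ} {r : ℝ} {E : Fin 2 → ℂ}
    (h : HasQuadraticFactor u L a r E) : IsSpectralPair u L a r E := by
  obtain ⟨hE, Q, hQ, hD, hQ0⟩ := h
  refine ⟨hE, fun z hz => ?_⟩
  have hQa : AnalyticAt ℂ Q z := hQ.analyticAt z
  rw [show curveDiscr u L = (fun y => y - E 0) * (fun y => y - E 1) * Q from funext hD,
    analyticOrderAt_mul (by fun_prop) hQa, analyticOrderAt_mul (by fun_prop) (by fun_prop),
    analyticOrderAt_sub_const, analyticOrderAt_sub_const,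
    analyticOrderAt_eq_zero.2 (Or.inr (hQ0 z hz)), Finset.card_filter, Fin.sum_univ_two]
  split_ifs <;> norm_num

theorem curveDiscr_eq {u : ℝ → ℂ} (hu : Continuous u) (L : ℝ) (z : ℂ) :
    curveDiscr u L z = (monodromy u L z).trace ^ 2 - 4 := by
  rw [curveDiscr, Matrix.discr_fin_two, det_monodromy hu, mul_one]

theorem HasQuadraticFactor.conj {u : ℝ → ℂ} (hu : Continuous u) {L : ℝ} {a : ℂ} {r : ℝ}
    {E : Fin 2 → ℂ} (h : HasQuadraticFactor u L a r E) :
    HasQuadraticFactor u L ((starRingEnd ℂ) a) r fun l => (starRingEnd ℂ) (E l) := by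
  obtain ⟨hE, Q, hQ, hD, hQ0⟩ := h
  have hball : ∀ z : ℂ, (starRingEnd ℂ) z ∈ Metric.ball ((starRingEnd ℂ) a) r ↔
      z ∈ Metric.ball a r := fun z => by
    rw [mem_ball_iff_norm, mem_ball_iff_norm, ← map_sub, RCLike.norm_conj]
  refine ⟨fun l => (hball _).2 (hE l), fun z => (starRingEnd ℂ) (Q ((starRingEnd ℂ) z)),
    fun z => ?_, fun z => ?_, fun z hz => ?_⟩
  · have := (hQ ((starRingEnd ℂ) z)).conj_conj
    rwa [Complex.conj_conj] at this
  · have h1 := congrArg (starRingEnd ℂ) (hD ((starRingEnd ℂ) z))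
    rw [curveDiscr_eq hu, trace_monodromy_conj hu] at h1
    rw [curveDiscr_eq hu]
    have h4 : (starRingEnd ℂ) (4 : ℂ) = 4 := map_ofNat _ 4
    simpa [h4] using h1
  · rw [ne_eq, map_eq_zero]
    exact hQ0 _ ((hball _).1 (by rwa [Complex.conj_conj]))

theorem IsSpectralPair.isBranchPoint {u : ℝ → ℂ} {L : ℝ} {a : ℂ} {r : ℝ} {E : Fin 2 → ℂ}
    (h : IsSpectralPair u L a r E) (hne : E 0 ≠ E 1) (l : Fin 2) : IsBranchPoint u L (E l) := by
  have h1 := h.2 (E l) (h.1 l)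
  have h2 : (Finset.univ.filter fun k => E k = E l).card = 1 := by
    rw [Finset.card_filter, Fin.sum_univ_two]
    fin_cases l <;> simp [hne, hne.symm]
  rw [h2] at h1
  rw [IsBranchPoint, analyticOrderNatAt, h1]
  exact odd_one

/-! ### Zeros of the discriminant near a double point. -/

theorem norm_root_le {m : ℝ} {w cp cm s : ℂ} {ε : ℝ} (hw0 : w ≠ 0) (hε : 0 ≤ ε)
    (hcp : ‖cp‖ ≤ ε) (hcm : ‖cm‖ ≤ ε)
    (hs : s ^ 2 = ((starRingEnd ℂ) cp - (m + w) ^ 2 * cm) *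
        ((starRingEnd ℂ) cm - (m - w) ^ 2 * cp)) :
    ‖1 / (2 * w) * s‖ ≤ (1 + (|m| + ‖w‖) ^ 2) / (2 * ‖w‖) * ε := by
  have hS1 : ‖(m : ℂ) + w‖ ≤ |m| + ‖w‖ := by simpa using norm_add_le (m : ℂ) w
  have hS2 : ‖(m : ℂ) - w‖ ≤ |m| + ‖w‖ := by simpa using norm_sub_le (m : ℂ) w
  have hfac : ∀ c d v : ℂ, ‖c‖ ≤ ε → ‖d‖ ≤ ε → ‖v‖ ≤ |m| + ‖w‖ →
      ‖(starRingEnd ℂ) c - v ^ 2 * d‖ ≤ (1 + (|m| + ‖w‖) ^ 2) * ε := fun c d v hc hd hv => by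
    refine (norm_sub_le _ _).trans ?_
    rw [RCLike.norm_conj, norm_mul, norm_pow, add_mul, one_mul]
    gcongr
  have h1 : ‖s‖ ≤ (1 + (|m| + ‖w‖) ^ 2) * ε := by
    refine abs_le_of_sq_le_sq' ?_ (by positivity) |>.2
    rw [← norm_pow, hs, norm_mul, sq ((1 + (|m| + ‖w‖) ^ 2) * ε)]
    exact mul_le_mul (hfac _ _ _ hcp hcm hS1) (hfac _ _ _ hcm hcp hS2) (norm_nonneg _)
      (by positivity)
  rw [norm_mul, norm_div, norm_one, norm_mul, Complex.norm_two]
  calc 1 / (2 * ‖w‖) * ‖s‖ ≤ 1 / (2 * ‖w‖) * ((1 + (|m| + ‖w‖) ^ 2) * ε) := by gcongr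
    _ = _ := by ring

/-- A crude bound, used to keep the other factor f - 4 of the discriminant away from zero: each of
the five terms is at most r. -/
theorem norm_le_of_norm_sub_le {K r ε : ℝ} (hK : 1 ≤ K) (hr : 0 < r) (hrK : K * r ≤ 1 / 16)
    (hε : 0 < ε) (hεr : K ^ 2 * ε ≤ r ^ 2 / 1000) {f Y ζ : ℂ} (hY : ‖Y‖ ≤ K * ε) (hζ : ‖ζ‖ ≤ r)
    (h : ‖f - (ζ ^ 2 - Y ^ 2)‖ ≤ K * (‖ζ‖ ^ 3 + ε ^ 2 * ‖ζ‖ + ε ^ 4)) : ‖f‖ ≤ 5 * r := by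
  have hr1 : r ≤ 1 := by nlinarith
  have hr2 : r ^ 2 ≤ r := by nlinarith
  have hK2 : K ≤ K ^ 2 := by nlinarith
  have hε1 : K * ε ≤ r ^ 2 / 1000 := (mul_le_mul_of_nonneg_right hK2 hε.le).trans hεr
  have hε2 : ε ≤ r ^ 2 / 1000 := (le_mul_of_one_le_left hε.le hK).trans hε1
  have hεε : ε ≤ 1 := by linarith
  have h2 := norm_add₃_le (a := f - (ζ ^ 2 - Y ^ 2)) (b := ζ ^ 2) (c := -Y ^ 2)
  rw [show f - (ζ ^ 2 - Y ^ 2) + ζ ^ 2 + -Y ^ 2 = f by ring, norm_neg, norm_pow, norm_pow] at h2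
  have h3 : ‖ζ‖ ^ 2 ≤ r := (pow_le_pow_left₀ (norm_nonneg _) hζ 2).trans hr2
  have hYr : ‖Y‖ ≤ r := by linarith
  have h4 : ‖Y‖ ^ 2 ≤ r := (pow_le_pow_left₀ (norm_nonneg _) hYr 2).trans hr2
  have h5 : K * ‖ζ‖ ^ 3 ≤ r := by
    have : K * ‖ζ‖ ≤ 1 := (mul_le_mul_of_nonneg_left hζ (by linarith)).trans (by linarith)
    calc K * ‖ζ‖ ^ 3 = K * ‖ζ‖ * ‖ζ‖ ^ 2 := by ring
      _ ≤ 1 * ‖ζ‖ ^ 2 := by gcongr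
      _ ≤ r := by linarith
  have h6 : K * (ε ^ 2 * ‖ζ‖) ≤ r := by
    calc K * (ε ^ 2 * ‖ζ‖) = K * ε * (ε * ‖ζ‖) := by ring
      _ ≤ r * (1 * 1) := by gcongr <;> linarith
      _ = r := by ring
  have h7 : K * ε ^ 4 ≤ r := by
    calc K * ε ^ 4 = K * ε * ε ^ 3 := by ring
      _ ≤ r * 1 := by
        gcongr
        · linarith
        · exact pow_le_one₀ hε.le hεε
      _ = r := by ring
  linarith

/-- The two zeros of the discriminant near a double point of the constant background. -/
theorem exists_pair {L : ℝ} (hL : 0 < L) {n : ℕ} (hn : 1 ≤ n) {w : ℂ}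
    (hw : w ^ 2 = mu L n ^ 2 - 1) (hw0 : w ≠ 0) :
    ∃ r₀ > (0 : ℝ), ∀ r, 0 < r → r ≤ r₀ → ∃ ε₀ > (0 : ℝ), ∃ C > (0 : ℝ), ∀ ε : ℝ, 0 < ε → ε < ε₀ →
      ∀ cp cm : ℂ, ‖cp‖ ≤ ε → ‖cm‖ ≤ ε → ∀ s : ℂ,
      s ^ 2 = ((starRingEnd ℂ) cp - (mu L n + w) ^ 2 * cm) *
        ((starRingEnd ℂ) cm - (mu L n - w) ^ 2 * cp) →
      ∃ E : Fin 2 → ℂ, HasQuadraticFactor (potential L n cp cm) L w r E ∧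
        (∀ l, (monodromy (potential L n cp cm) L (E l)).trace = 2 * (-1) ^ n) ∧
        ‖E 0 - (w - 1 / (2 * w) * s)‖ ≤ C * ε ^ 2 ∧ ‖E 1 - (w + 1 / (2 * w) * s)‖ ≤ C * ε ^ 2 := by
  have hm' : (mu L n : ℂ) ≠ 0 := by exact_mod_cast mu_ne_zero hL hn
  have hL' : (L : ℂ) ≠ 0 := by exact_mod_cast hL.ne'
  obtain ⟨K₀, hK₀, hexp⟩ := exists_trace_expansion hL hn hw hw0
  set A : ℂ := mu L n ^ 2 / (L ^ 2 * w ^ 2) with hA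
  have hA0 : A ≠ 0 := by rw [hA]; positivity
  set S : ℝ := |mu L n| + ‖w‖ with hS
  set K : ℝ := max K₀ ((1 + S ^ 2) / (2 * ‖w‖)) with hK
  have hK1 : 1 ≤ K := hK₀.trans (le_max_left _ _)
  have hAn : 0 < ‖A‖ := norm_pos_iff.2 hA0
  -- The first bound is what the splitting lemma needs. The second gives 5r < 4‖A‖, so F ≠ 4A in the
  -- disc. Every smaller r is allowed, so that the discs at λ_n and -λ_n can share one radius.
  refine ⟨min (1 / (16 * K)) (‖A‖ / 2), by positivity, fun r hr hr₀ => ?_⟩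
  have hrK : K * r ≤ 1 / 16 := by
    have := hr₀.trans (min_le_left _ _)
    rw [le_div_iff₀ (by positivity)] at this
    linarith
  have hrA : r ≤ ‖A‖ / 2 := hr₀.trans (min_le_right _ _)
  refine ⟨r ^ 2 / 1000 / K ^ 2, by positivity, 50 * K ^ 4, by positivity,
    fun ε hε hεr cp cm hcp hcm s hs => ?_⟩
  have hKε : K ^ 2 * ε ≤ r ^ 2 / 1000 := by
    rw [lt_div_iff₀ (by positivity)] at hεr
    linarith
  have hε' : (ε : ℂ) ≠ 0 := by exact_mod_cast hε.ne'
  have hr1 : r ≤ 1 := by nlinarith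
  have hε2 : ε ≤ 1 := by nlinarith
  have hu := continuous_potential L n cp cm
  set F : ℂ → ℂ := fun ζ => A * (2 - (-1) ^ n * (monodromy (potential L n cp cm) L (w + ζ)).trace)
    with hF
  have hFd : Differentiable ℂ F := by
    have := (differentiable_trace_monodromy hu hL).comp (differentiable_id.const_add w)
    exact ((this.const_mul _).const_sub _).const_mul _
  set Y : ℂ := 1 / (2 * w) * s with hY
  have hYn : ‖Y‖ ≤ K * ε := (norm_root_le hw0 hε.le hcp hcm hs).trans
    (mul_le_mul_of_nonneg_right (le_max_right _ _) hε.le)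
  have hest : ∀ ζ : ℂ, ‖ζ‖ ≤ r →
      ‖F ζ - (ζ ^ 2 - Y ^ 2)‖ ≤ K * (‖ζ‖ ^ 3 + ε ^ 2 * ‖ζ‖ + ε ^ 4) := by
    intro ζ hζ
    -- Rescaling with t = ε makes the coefficients bounded by 1, so the constant K₀ is uniform in
    -- them.
    have h1 := hexp (cp / ε) (cm / ε) (by
        rw [norm_div, norm_real, Real.norm_of_nonneg hε.le]
        exact div_le_one_of_le₀ hcp hε.le) (by
        rw [norm_div, norm_real, Real.norm_of_nonneg hε.le]
        exact div_le_one_of_le₀ hcm hε.le) ζ ε (hζ.trans hr1) hε.le hε2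
    rw [mul_div_cancel₀ _ hε', mul_div_cancel₀ _ hε',
      show (ε : ℂ) ^ 2 * (((starRingEnd ℂ) (cp / ε) - (mu L n + w) ^ 2 * (cm / ε)) *
        ((starRingEnd ℂ) (cm / ε) - (mu L n - w) ^ 2 * (cp / ε))) / (4 * w ^ 2) = Y ^ 2 by
      rw [hY, mul_pow, hs, map_div₀, map_div₀, conj_ofReal]
      field_simp
      ring] at h1
    exact h1.trans (mul_le_mul_of_nonneg_right (le_max_left _ _) (by positivity))
  obtain ⟨z₀, z₁, q, hq, hFq, hq0, hz₀, hz₁, hY₀, hY₁⟩ :=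
    exists_split_of_norm_sub_le hK1 hr hrK hε hKε hFd hYn hest
  have hF4 : ∀ ζ : ℂ, ‖ζ‖ ≤ r → F ζ ≠ 4 * A := by
    intro ζ hζ h4
    have h1 := norm_le_of_norm_sub_le hK1 hr hrK hε hKε hYn hζ (hest ζ hζ)
    rw [h4, norm_mul, Complex.norm_ofNat] at h1
    linarith
  have hσ : ((-1 : ℂ) ^ n) ^ 2 = 1 := by rw [← pow_mul, mul_comm, pow_mul]; simp
  have hz : ∀ z : ℂ, ‖z‖ < r → w + z ∈ Metric.ball w r := fun z hz => by
    rw [mem_ball_iff_norm, add_sub_cancel_left]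
    exact hz
  have htr : ∀ z, F z = 0 →
      (monodromy (potential L n cp cm) L (w + z)).trace = 2 * (-1) ^ n := fun z h0 => by
    have := (mul_eq_zero.1 h0).resolve_left hA0
    linear_combination (-(-1) ^ n) * this -
      (monodromy (potential L n cp cm) L (w + z)).trace * hσ
  -- With f = F/A the discriminant is f (f - 4); the first factor carries the two zeros, the second
  -- none.
  refine ⟨![w + z₀, w + z₁], ⟨?_, fun z => q (z - w) / A * (F (z - w) / A - 4), ?_, fun z => ?_,
    fun z hz => ?_⟩, ?_, ?_, ?_⟩
  · intro l
    fin_cases l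
    · exact hz z₀ (mem_ball_zero_iff.1 hz₀)
    · exact hz z₁ (mem_ball_zero_iff.1 hz₁)
  · have h1 : Differentiable ℂ fun z => q (z - w) := hq.comp (differentiable_id.sub_const w)
    have h2 : Differentiable ℂ fun z => F (z - w) := hFd.comp (differentiable_id.sub_const w)
    fun_prop
  · have h1 : (z - w - z₀) * (z - w - z₁) * q (z - w) / A =
        2 - (-1) ^ n * (monodromy (potential L n cp cm) L z).trace := by
      rw [← hFq (z - w), hF]
      simp only [add_sub_cancel]
      field_simp
    have h2 : F (z - w) / A = 2 - (-1) ^ n * (monodromy (potential L n cp cm) L z).trace := by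
      rw [hF]
      simp only [add_sub_cancel]
      field_simp
    simp only [curveDiscr_eq hu, h2, Matrix.cons_val_zero, Matrix.cons_val_one]
    rw [show ∀ p : ℂ, (z - (w + z₀)) * (z - (w + z₁)) * (q (z - w) / A * p) =
      ((z - w - z₀) * (z - w - z₁) * q (z - w) / A) * p from fun p => by ring, h1]
    linear_combination (-(monodromy (potential L n cp cm) L z).trace ^ 2) * hσ
  · rw [mem_ball_iff_norm] at hz
    refine mul_ne_zero (div_ne_zero (hq0 _ (mem_ball_zero_iff.2 hz)) hA0) fun h => ?_
    rw [sub_eq_zero, div_eq_iff hA0] at h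
    exact hF4 _ hz.le h
  · intro l
    fin_cases l
    · exact htr z₀ (by rw [hFq]; ring)
    · exact htr z₁ (by rw [hFq]; ring)
  · simpa [show w + z₀ - (w - Y) = z₀ + Y by ring] using hY₀
  · simpa [show w + z₁ - (w + Y) = z₁ - Y by ring] using hY₁

/-- On the constant background the double points are double zeros of the discriminant. -/
theorem analyticOrderAt_background {L : ℝ} (hL : 0 < L) {n : ℕ} (hn : 1 ≤ n) {w : ℂ}
    (hw : w ^ 2 = mu L n ^ 2 - 1) (hw0 : w ≠ 0) :
    analyticOrderAt (curveDiscr (potential L n 0 0) L) w = 2 := by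
  obtain ⟨r, hr, h⟩ := exists_pair hL hn hw hw0
  obtain ⟨ε₀, hε₀, C, hC, h⟩ := h r hr le_rfl
  have key : ∀ ε, 0 < ε → ε < ε₀ → ∃ E : Fin 2 → ℂ,
      IsSpectralPair (potential L n 0 0) L w r E ∧ ∀ l, ‖E l - w‖ ≤ C * ε ^ 2 := by
    intro ε hε hε'
    obtain ⟨E, hE, -, h0, h1⟩ := h ε hε hε' 0 0 (by simpa using hε.le) (by simpa using hε.le) 0
      (by simp)
    refine ⟨E, hE.isSpectralPair, fun l => ?_⟩
    fin_cases l
    · simpa using h0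
    · simpa using h1
  obtain ⟨E, hE, -⟩ := key (ε₀ / 2) (by positivity) (by linarith)
  have hEw : ∀ l, E l = w := by
    intro l
    by_contra hne
    have hd : 0 < ‖E l - w‖ := norm_pos_iff.2 (sub_ne_zero.2 hne)
    -- For zero perturbation every small ε is admissible. The zeros in the fixed disc do not depend
    -- on ε, so E l must also lie within C ε² of w, and this ε makes that at most half its distance.
    set ε := min (ε₀ / 2) (min 1 (‖E l - w‖ / (2 * C))) with hε
    have hε0 : 0 < ε := by positivity
    have hε1 : ε ≤ 1 := (min_le_right _ _).trans (min_le_left _ _)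
    have hε2 : ε ≤ ‖E l - w‖ / (2 * C) := (min_le_right _ _).trans (min_le_right _ _)
    obtain ⟨E', hE', hd'⟩ := key ε hε0 ((min_le_left _ _).trans_lt (by linarith))
    have h1 := (hE.2 (E l) (hE.1 l)).symm.trans (hE'.2 (E l) (hE.1 l))
    have h2 : (Finset.univ.filter fun k => E' k = E l).card ≠ 0 := by
      have h3 : (Finset.univ.filter fun k => E k = E l).card =
        (Finset.univ.filter fun k => E' k = E l).card := by exact_mod_cast h1
      rw [← h3]
      exact Finset.card_ne_zero_of_mem (Finset.mem_filter.2 ⟨Finset.mem_univ l, rfl⟩)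
    obtain ⟨k, hk⟩ := Finset.card_ne_zero.1 h2
    have h4 := hd' k
    rw [(Finset.mem_filter.1 hk).2] at h4
    rw [le_div_iff₀ (by positivity)] at hε2
    nlinarith
  have h1 := hE.2 w (Metric.mem_ball_self hr)
  rw [h1]
  simp [hEw]

/-! ### The values ±λ_n and the final assembly. -/

theorem lam_sq (L : ℝ) {n : ℕ} (h : 0 ≤ mu L n) : lam L n ^ 2 = mu L n ^ 2 - 1 := by
  unfold lam
  split_ifs with h1
  · rw [mul_pow, I_sq, ← ofReal_pow, Real.sq_sqrt (by nlinarith)]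
    push_cast
    ring
  · rw [← ofReal_pow, Real.sq_sqrt (by nlinarith)]
    push_cast
    ring

theorem conj_lam_of_lt {L : ℝ} {n : ℕ} (h : mu L n < 1) :
    (starRingEnd ℂ) (lam L n) = -lam L n := by
  rw [lam, if_pos h, map_mul, conj_I, conj_ofReal, neg_mul]

/-- Consequences of the positions of two spectral points for their difference. -/
theorem splitting_of_positions {w s e₀ e₁ : ℂ} (hw : w ≠ 0) {δ : ℝ}
    (h₀ : ‖e₀ - (w - 1 / (2 * w) * s)‖ ≤ δ) (h₁ : ‖e₁ - (w + 1 / (2 * w) * s)‖ ≤ δ) :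
    ‖(e₁ - e₀) - s / w‖ ≤ 2 * δ ∧ (2 * ‖w‖ * δ < ‖s‖ → e₀ ≠ e₁) := by
  have h : ‖(e₁ - e₀) - s / w‖ ≤ 2 * δ := by
    have := norm_sub_le (e₁ - (w + 1 / (2 * w) * s)) (e₀ - (w - 1 / (2 * w) * s))
    rw [show e₁ - (w + 1 / (2 * w) * s) - (e₀ - (w - 1 / (2 * w) * s)) = (e₁ - e₀) - s / w by
      field_simp; ring] at this
    linarith
  refine ⟨h, fun hs heq => ?_⟩
  rw [heq, sub_self, zero_sub, norm_neg, norm_div, div_le_iff₀ (norm_pos_iff.2 hw)] at h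
  linarith

end ZakharovShabat

theorem mainTheorem5 (L : ℝ) (hL : 0 < L) (n : ℕ) (hn : 1 ≤ n) (hLn : L ≠ Real.pi * n) :
    -- without perturbation, `± λ_n` are double points
    (∀ a : ℂ, a = lam L n ∨ a = -lam L n →
      monodromy (potential L n 0 0) L a = (-1 : ℂ) ^ n • (1 : Matrix (Fin 2) (Fin 2) ℂ) ∧
      analyticOrderAt (curveDiscr (potential L n 0 0) L) a = 2) ∧
    ∃ r > (0 : ℝ), ∃ ε₀ > (0 : ℝ), ∃ C > (0 : ℝ), ∀ ε : ℝ, 0 < ε → ε < ε₀ →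
      ∀ cp cm : ℂ, ‖cp‖ ≤ ε → ‖cm‖ ≤ ε →
      ∀ s s' : ℂ, s ^ 2 = alpha L n cp cm * beta L n cp cm →
        s' ^ 2 = alphaTilde L n cp cm * betaTilde L n cp cm →
      ∃ E E' : Fin 2 → ℂ,
        -- each double point becomes a pair of spectral points
        IsSpectralPair (potential L n cp cm) L (lam L n) r E ∧
        IsSpectralPair (potential L n cp cm) L (-lam L n) r E' ∧
        (∀ l, IsBlochEigenvalue (potential L n cp cm) L ((-1) ^ n) (E l) ∧
          IsBlochEigenvalue (potential L n cp cm) L ((-1) ^ n) (E' l)) ∧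
        -- positions
        ‖E 0 - (lam L n - 1 / (2 * lam L n) * s)‖ ≤ C * ε ^ 2 ∧
        ‖E 1 - (lam L n + 1 / (2 * lam L n) * s)‖ ≤ C * ε ^ 2 ∧
        ‖E' 0 - (-lam L n + 1 / (2 * lam L n) * s')‖ ≤ C * ε ^ 2 ∧
        ‖E' 1 - (-lam L n - 1 / (2 * lam L n) * s')‖ ≤ C * ε ^ 2 ∧
        -- leading-order splitting
        ‖(E 1 - E 0) - s / lam L n‖ ≤ C * ε ^ 2 ∧
        ‖(E' 1 - E' 0) - (-s' / lam L n)‖ ≤ C * ε ^ 2 ∧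
        -- genuine splitting into two branch points
        (C * ε ^ 2 < ‖s‖ → E 0 ≠ E 1 ∧
          ∀ l, IsBranchPoint (potential L n cp cm) L (E l)) ∧
        (C * ε ^ 2 < ‖s'‖ → E' 0 ≠ E' 1 ∧
          ∀ l, IsBranchPoint (potential L n cp cm) L (E' l)) ∧
        -- conjugation symmetry for an unstable mode
        (Real.pi * n < L → s' = (starRingEnd ℂ) s →
          (∀ l, E' l = (starRingEnd ℂ) (E l)) ∧
          E' 1 - E' 0 = (starRingEnd ℂ) (E 1 - E 0)) := by
  have hmu : 0 < mu L n := by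
    have : 0 < n := hn
    unfold mu
    positivity
  have hw : lam L n ^ 2 = mu L n ^ 2 - 1 := lam_sq L hmu.le
  have hw' : (-lam L n) ^ 2 = mu L n ^ 2 - 1 := by rw [neg_sq, hw]
  have hmu1 : mu L n ≠ 1 := fun h => hLn (by
    unfold mu at h
    rw [div_eq_one_iff_eq hL.ne'] at h
    exact h.symm)
  have hw0 : lam L n ≠ 0 := fun h => hmu1 (by
    rw [h, zero_pow two_ne_zero, eq_comm, sub_eq_zero] at hw
    have h2 : mu L n ^ 2 = 1 := by exact_mod_cast hw
    exact (pow_eq_one_iff_of_nonneg hmu.le two_ne_zero).1 h2)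
  have hw0' : -lam L n ≠ 0 := neg_ne_zero.2 hw0
  refine ⟨fun a ha => ?_, ?_⟩
  · rcases ha with rfl | rfl
    · exact ⟨monodromy_background hL hn hw, analyticOrderAt_background hL hn hw hw0⟩
    · exact ⟨monodromy_background hL hn hw', analyticOrderAt_background hL hn hw' hw0'⟩
  obtain ⟨r₁, hr₁, h₁⟩ := exists_pair hL hn hw hw0
  obtain ⟨r₂, hr₂, h₂⟩ := exists_pair hL hn hw' hw0'
  obtain ⟨ε₁, hε₁, C₁, hC₁, h₁⟩ := h₁ (min r₁ r₂) (by positivity) (min_le_left _ _)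
  obtain ⟨ε₂, hε₂, C₂, hC₂, h₂⟩ := h₂ (min r₁ r₂) (by positivity) (min_le_right _ _)
  set C₀ := C₁ + C₂ with hC₀
  -- The factor 2 serves the differences of two positions; 2‖λ_n‖ converts a lower bound on ‖s‖ into
  -- E 0 ≠ E 1.
  refine ⟨min r₁ r₂, by positivity, min ε₁ ε₂, by positivity, 2 * (1 + ‖lam L n‖) * C₀,
    by positivity, fun ε hε hεε cp cm hcp hcm s s' hs hs' => ?_⟩
  have hu := continuous_potential L n cp cm
  have hper := potential_add_period hL n cp cm
  have hσ : ((-1 : ℂ) ^ n) ^ 2 = 1 := by rw [← pow_mul, mul_comm, pow_mul]; simp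
  obtain ⟨E, hE, hEt, hE0, hE1⟩ := h₁ ε hε (hεε.trans_le (min_le_left _ _)) cp cm hcp hcm s hs
  obtain ⟨E', hE', hEt', hE0', hE1', hconj⟩ : ∃ E' : Fin 2 → ℂ,
      HasQuadraticFactor (potential L n cp cm) L (-lam L n) (min r₁ r₂) E' ∧
      (∀ l, (monodromy (potential L n cp cm) L (E' l)).trace = 2 * (-1) ^ n) ∧
      ‖E' 0 - (-lam L n - 1 / (2 * -lam L n) * s')‖ ≤ C₀ * ε ^ 2 ∧
      ‖E' 1 - (-lam L n + 1 / (2 * -lam L n) * s')‖ ≤ C₀ * ε ^ 2 ∧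
      (Real.pi * n < L → s' = (starRingEnd ℂ) s → ∀ l, E' l = (starRingEnd ℂ) (E l)) := by
    have hε2 : 0 ≤ ε ^ 2 := sq_nonneg ε
    -- In the symmetric case E' is defined as the conjugate of E, so the symmetry is exact.
    -- Otherwise the expansion at -λ_n is used; there w = -λ_n turns α, β into α̃, β̃.
    by_cases hc : Real.pi * n < L ∧ s' = (starRingEnd ℂ) s
    · have hlam : (starRingEnd ℂ) (lam L n) = -lam L n := by
        refine conj_lam_of_lt ?_
        unfold mu
        rw [div_lt_one hL]
        exact hc.1
      refine ⟨fun l => (starRingEnd ℂ) (E l), hlam ▸ hE.conj hu, fun l => ?_, ?_, ?_,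
        fun _ _ _ => rfl⟩
      · rw [trace_monodromy_conj hu, hEt]
        simp [Complex.conj_ofNat]
      · rw [← RCLike.norm_conj] at hE0
        have e : (starRingEnd ℂ) (E 0 - (lam L n - 1 / (2 * lam L n) * s)) =
            (starRingEnd ℂ) (E 0) - (-lam L n - 1 / (2 * -lam L n) * s') := by
          simp [hlam, hc.2, Complex.conj_ofNat]
        rw [e] at hE0
        nlinarith
      · rw [← RCLike.norm_conj] at hE1
        have e : (starRingEnd ℂ) (E 1 - (lam L n + 1 / (2 * lam L n) * s)) =
            (starRingEnd ℂ) (E 1) - (-lam L n + 1 / (2 * -lam L n) * s') := by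
          simp [hlam, hc.2, Complex.conj_ofNat]
        rw [e] at hE1
        nlinarith
    · obtain ⟨E', hE', hEt', h0, h1⟩ := h₂ ε hε (hεε.trans_le (min_le_right _ _)) cp cm hcp hcm s'
        (by rw [hs', alphaTilde, betaTilde, ← sub_eq_add_neg, sub_neg_eq_add])
      exact ⟨E', hE', hEt', by nlinarith, by nlinarith, fun h h' => absurd ⟨h, h'⟩ hc⟩
  have hε2 : 0 < ε ^ 2 := by positivity
  have hE0₀ : ‖E 0 - (lam L n - 1 / (2 * lam L n) * s)‖ ≤ C₀ * ε ^ 2 := by nlinarith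
  have hE1₀ : ‖E 1 - (lam L n + 1 / (2 * lam L n) * s)‖ ≤ C₀ * ε ^ 2 := by nlinarith
  have hC0 : 0 < C₀ * ε ^ 2 := by positivity
  have hCle : 2 * (C₀ * ε ^ 2) ≤ 2 * (1 + ‖lam L n‖) * C₀ * ε ^ 2 := by
    nlinarith [norm_nonneg (lam L n)]
  have hCle' : 2 * ‖lam L n‖ * (C₀ * ε ^ 2) ≤ 2 * (1 + ‖lam L n‖) * C₀ * ε ^ 2 := by
    nlinarith
  obtain ⟨hd, hne⟩ := splitting_of_positions hw0 hE0₀ hE1₀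
  obtain ⟨hd', hne'⟩ := splitting_of_positions hw0' hE0' hE1'
  rw [norm_neg] at hne'
  refine ⟨E, E', hE.isSpectralPair, hE'.isSpectralPair, fun l =>
    ⟨isBlochEigenvalue_of_trace hu hper hσ (hEt l),
      isBlochEigenvalue_of_trace hu hper hσ (hEt' l)⟩, by linarith, by linarith, ?_, ?_,
    by linarith, ?_, fun h => ?_, fun h => ?_, fun h h' => ?_⟩
  · rw [show -lam L n + 1 / (2 * lam L n) * s' = -lam L n - 1 / (2 * -lam L n) * s' by
      rw [mul_neg, div_neg]; ring]
    linarith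
  · rw [show -lam L n - 1 / (2 * lam L n) * s' = -lam L n + 1 / (2 * -lam L n) * s' by
      rw [mul_neg, div_neg]; ring]
    linarith
  · rw [show -s' / lam L n = s' / -lam L n by rw [div_neg, neg_div]]
    linarith
  · have := hne (by linarith)
    exact ⟨this, hE.isSpectralPair.isBranchPoint this⟩
  · have := hne' (by linarith)
    exact ⟨this, hE'.isSpectralPair.isBranchPoint this⟩
  · have := hconj h h'
    exact ⟨this, by rw [this, this, map_sub]⟩
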